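/- All graphs are finite, simple and undirected; $\Delta(G)$ is the maximum degree of $G$. A walk in $G$ is a non-empty sequence $v_1,\dots,v_n$ of vertices with $v_iv_{i+1}\in E(G)$ for $1\le i<n$; its length is $n$ and its order is the number of distinct vertices in it. It is a path if its vertices are pairwise distinct. A walk $v_1,\dots,v_{2t}$ is repetitively coloured by a vertex colouring $\varphi$ if $\varphi(v_i)=\varphi(v_{t+i})$ for all $i\in\{1,\dots,t\}$, and is boring if $v_i=v_{t+i}$ for all $i\in\{1,\dots,t\}$. A colouring is walk-nonrepetitive if every repetitively coloured walk is boring, path-nonrepetitive if no path is repetitively coloured, and distance-$2$ if any two distinct vertices at distance at most $2$ receive different colours. Let $\sigma(G)$ be the minimum number of colours in a walk-nonrepetitive colouring of $G$, and for an integer $\Delta\ge 0$ let $\sigma(\Delta)$ be the supremum of $\sigma(G)$ over all graphs $G$ with $\Delta(G)\le\Delta$. Conjecture SmallWalks is the following assertion: there is a function $h:\mathbb{N}\to\mathbb{N}$ such that, for every graph $G$ and every path-nonrepetitive distance-$2$ colouring of $G$ with $c$ colours for which $G$ contains a repetitively coloured non-boring walk, $G$ contains a repetitively coloured non-boring walk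 whose length is at most $h(c)\cdot k$, where $k$ is the order of that walk. Theorem. If Conjecture SmallWalks is true, then there is a function $f:\mathbb{N}\to\mathbb{N}$ such that $\sigma(\Delta)\le f(\Delta)$ for every integer $\Delta\ge 0$, and every graph $G$ has a walk-nonrepetitive colouring with $f(\Delta(G))$ colours. -/

import Mathlib

namespace WalkColouring

variable {V : Type*} {C : Type*}

/-- A walk `v_1, …, v_n` is a `SimpleGraph.Walk`; its length is its number of entries `n`,
which is one more than Mathlib's number of edges `p.length`. -/
def walkLength {G : SimpleGraph V} {u v : V} (p : G.Walk u v) : ℕ :=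
  p.support.length

/-- The order of a walk is its number of distinct vertices. -/
noncomputable def walkOrder {G : SimpleGraph V} {u v : V} (p : G.Walk u v) : ℕ :=
  {x : V | x ∈ p.support}.ncard

/-- A walk `v_1, …, v_{2t}` is repetitively coloured by `f` if `f v_i = f v_{t+i}` for all
`1 ≤ i ≤ t`. Here `p.getVert i` is `v_{i+1}`. -/
def IsRepetitive {G : SimpleGraph V} (f : V → C) {u v : V} (p : G.Walk u v) : Prop :=
  ∃ t : ℕ, walkLength p = 2 * t ∧ ∀ i < t, f (p.getVert i) = f (p.getVert (t + i))

/-- A walk `v_1, …, v_{2t}` is boring if `v_i = v_{t+i}` for all `1 ≤ i ≤ t`. -/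
def IsBoring {G : SimpleGraph V} {u v : V} (p : G.Walk u v) : Prop :=
  ∃ t : ℕ, walkLength p = 2 * t ∧ ∀ i < t, p.getVert i = p.getVert (t + i)

/-- The only walks that are repetitively coloured by `f` are boring. -/
def IsWalkNonrepetitive (G : SimpleGraph V) (f : V → C) : Prop :=
  ∀ (u v : V) (p : G.Walk u v), IsRepetitive f p → IsBoring p

/-- No path is repetitively coloured by `f`. -/
def IsPathNonrepetitive (G : SimpleGraph V) (f : V → C) : Prop :=
  ∀ (u v : V) (p : G.Walk u v), p.IsPath → ¬ IsRepetitive f p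

/-- The square of `G`: distinct vertices are adjacent if their distance in `G` is at most 2. -/
def square (G : SimpleGraph V) : SimpleGraph V where
  Adj v w := v ≠ w ∧ G.edist v w ≤ 2
  symm := ⟨fun v w h => ⟨h.1.symm, by rw [SimpleGraph.edist_comm]; exact h.2⟩⟩
  loopless := ⟨fun _ h => h.1 rfl⟩

/-- A distance-2 colouring of `G` is a proper colouring of its square. -/
def IsDistanceTwoColouring (G : SimpleGraph V) (f : V → C) : Prop :=
  ∀ v w : V, (square G).Adj v w → f v ≠ f w

/-- The conjecture on small walks: for some function `h`, whenever a path-nonrepetitive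
distance-2 colouring of a finite graph with `c` colours admits a repetitively coloured non-boring
walk, it admits one of length at most `h c` times its order. -/
def SmallWalksConjecture : Prop :=
  ∃ h : ℕ → ℕ, ∀ (V : Type) [Fintype V] (G : SimpleGraph V) (c : ℕ) (f : V → Fin c),
    IsPathNonrepetitive G f → IsDistanceTwoColouring G f →
    (∃ (u v : V) (p : G.Walk u v), IsRepetitive f p ∧ ¬ IsBoring p) →
    ∃ (u v : V) (p : G.Walk u v), IsRepetitive f p ∧ ¬ IsBoring p ∧
      walkLength p ≤ h c * walkOrder p

/-- `σ(G)`: the minimum number of colours in a walk-nonrepetitive colouring of `G`. -/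
noncomputable def sigma (G : SimpleGraph V) : ℕ :=
  sInf {k : ℕ | ∃ f : V → Fin k, IsWalkNonrepetitive G f}

open Classical in
/-- `σ(Δ)`: the supremum in `ℕ∞` of `σ(G)` over all finite graphs `G` with maximum degree at most
`Δ` (every finite graph is isomorphic to one on some `Fin n`). -/
noncomputable def sigmaDegree (Δ : ℕ) : ℕ∞ :=
  ⨆ (n : ℕ) (G : SimpleGraph (Fin n)) (_ : G.maxDegree ≤ Δ), (sigma G : ℕ∞)

/-- The minimum defining `σ(G)` is attained for every finite graph. -/
theorem exists_sigma_colouring [Finite V] (G : SimpleGraph V) :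
    ∃ f : V → Fin (sigma G), IsWalkNonrepetitive G f := by
  have hne : {k : ℕ | ∃ f : V → Fin k, IsWalkNonrepetitive G f}.Nonempty := by
    refine ⟨Nat.card V, Finite.equivFin V, ?_⟩
    rintro u v p ⟨t, ht, h⟩
    exact ⟨t, ht, fun i hi => (Finite.equivFin V).injective (h i hi)⟩
  exact Nat.sInf_mem hne

end WalkColouring

/-!
Repetitions that are short relative to their order can be avoided with boundedly many colours: the
number of such walks through a vertex is at most exponential in their order, a walk whose halves
disagree everywhere is repetitively coloured with probability at most `k ^ (-o / 2)`, where `o` is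
its order and `k` the number of colours, and so a counting argument in the style of Rosenfeld finds
a colouring without them.

The conjecture bounds the length of a shortest repetition by a multiple of its order that depends
on the number of colours, so the number of colours must not depend on that multiple. To break this
circle, take a distance-2 colouring `g` of `G` with boundedly many colours, apply the conjecture to
`G` with every edge subdivided `N` times, and encode a second colouring `ψ` with `N` colours in
unary along the subdivided edges. The subdivided graph needs a number of colours independent of
`N`, and traversing an edge reveals the colours `ψ` of both ends. Short repetitions of the
subdivided graph project to short repetitions of `G` under both `g` and `ψ`; now `N` can be chosen
large enough for `ψ` to avoid them all, so the subdivided graph has no non-boring repetition. A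
non-boring repetition of `G` under `(g, ψ)` and the colours of neighbours would lift to one.
-/

namespace WalkColouring

open scoped Finset

section Counting

variable {V C ι : Type*}

/-- A set `A` of colourings is determined on `D` if a colouring in `A` can be recovered from its
restriction to the complement of `D`. -/
def IsDeterminedOn (A : Set (V → C)) (D : Finset V) : Prop :=
  ∀ f ∈ A, ∀ f' ∈ A, (∀ x ∉ D, f x = f' x) → f = f'

theorem pow_card_sdiff_mul_le [DecidableEq V] {F : Finset V → ℝ} {a b : ℝ} {S : Finset V}
    (ha : 0 ≤ a) (hb : 0 ≤ b)
    (hF : ∀ R ⊂ S, ∀ v ∉ R, a * F R ≤ b * F (insert v R)) {T : Finset V} (hT : T ⊆ S) :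
    a ^ #(S \ T) * F T ≤ b ^ #(S \ T) * F S := by
  induction hk : #(S \ T) generalizing T with
  | zero =>
    rw [Finset.card_eq_zero, Finset.sdiff_eq_empty_iff_subset] at hk
    simp [hT.antisymm hk]
  | succ k ih =>
    obtain ⟨x, hx⟩ : (S \ T).Nonempty := Finset.card_pos.1 (by lia)
    have hk' : #(S \ insert x T) = k := by
      rw [Finset.sdiff_insert, Finset.card_erase_of_mem hx, hk, Nat.add_sub_cancel]
    rw [Finset.mem_sdiff] at hx
    calc a ^ (k + 1) * F T = a ^ k * (a * F T) := by ring
      _ ≤ a ^ k * (b * F (insert x T)) :=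
        mul_le_mul_of_nonneg_left (hF T (hT.ssubset_of_mem_notMem hx.1 hx.2) x hx.2)
          (pow_nonneg ha k)
      _ = b * (a ^ k * F (insert x T)) := by ring
      _ ≤ b * (b ^ k * F S) :=
        mul_le_mul_of_nonneg_left (ih (Finset.insert_subset hx.1 hT) hk') hb
      _ = b ^ (k + 1) * F S := by ring

variable [Fintype V] [Fintype C]

open Classical in
/-- The colourings that avoid every event `bad e`, `e ∈ s`, whose support lies in `S`. Colours
outside `S` are unrestricted. -/
noncomputable def colouringsAvoidingWithin (s : Finset ι) (supp : ι → Finset V)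
    (bad : ι → Set (V → C)) (S : Finset V) : Finset (V → C) :=
  {f | ∀ e ∈ s, supp e ⊆ S → f ∉ bad e}

variable {s : Finset ι} {supp : ι → Finset V} {bad : ι → Set (V → C)} {S T D : Finset V}

theorem mem_colouringsAvoidingWithin {f : V → C} :
    f ∈ colouringsAvoidingWithin s supp bad S ↔ ∀ e ∈ s, supp e ⊆ S → f ∉ bad e := by
  simp [colouringsAvoidingWithin]

theorem colouringsAvoidingWithin_antitone (hTS : T ⊆ S) :
    colouringsAvoidingWithin s supp bad S ⊆ colouringsAvoidingWithin s supp bad T := by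
  intro f hf
  rw [mem_colouringsAvoidingWithin] at hf ⊢
  exact fun e he h => hf e he (h.trans hTS)

open Classical in
theorem card_filter_mem_mul_pow_le (hlocal : ∀ e ∈ s, DependsOn (· ∈ bad e) (supp e : Set V))
    (hTD : Disjoint T D) {A : Set (V → C)} (hA : IsDeterminedOn A D) :
    #{f ∈ colouringsAvoidingWithin s supp bad T | f ∈ A} * Fintype.card C ^ #D ≤
      #(colouringsAvoidingWithin s supp bad T) := by
  have hcard : Fintype.card C ^ #D = #(Finset.univ : Finset (D → C)) := by simp
  rw [hcard, ← Finset.card_product]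
  refine Finset.card_le_card_of_injOn
    (fun q x => if h : x ∈ D then q.2 ⟨x, h⟩ else q.1 x) ?_ ?_
  · rintro ⟨f, κ⟩ hf
    simp only [Finset.coe_product, Set.mem_prod, Finset.mem_coe, Finset.mem_filter,
      mem_colouringsAvoidingWithin] at hf ⊢
    intro e he heT hbad
    refine hf.1.1 e he heT ((hlocal e he fun x hx => ?_).mp hbad)
    exact dif_neg (Finset.disjoint_left.1 hTD (heT hx))
  · rintro ⟨f, κ⟩ hf ⟨f', κ'⟩ hf' heq
    simp only [Finset.coe_product, Set.mem_prod, Finset.mem_coe, Finset.mem_filter] at hf hf'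
    refine Prod.ext (hA f hf.1.2 f' hf'.1.2 fun x hx => ?_) (funext fun x => ?_)
    · simpa [hx] using congrFun heq x
    · simpa using congrFun heq x

variable [DecidableEq V]

open Classical in
theorem card_filter_mem_mul_card_le {β : ℝ} (hβ : 0 < β)
    (hlocal : ∀ e ∈ s, DependsOn (· ∈ bad e) (supp e : Set V))
    (hchain : ∀ T ⊆ S, β ^ #(S \ T) * #(colouringsAvoidingWithin s supp bad T) ≤
      (Fintype.card C : ℝ) ^ #(S \ T) * #(colouringsAvoidingWithin s supp bad S))
    {v : V} (hv : v ∉ S) (hvD : v ∈ D) (hDS : D ⊆ insert v S)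
    {A : Set (V → C)} (hA : IsDeterminedOn A D) :
    (#{f ∈ colouringsAvoidingWithin s supp bad S | f ∈ A} : ℝ) * Fintype.card C ≤
      #(colouringsAvoidingWithin s supp bad S) * (β / β ^ #D) := by
  set F := colouringsAvoidingWithin s supp bad
  obtain hC | hC := (Fintype.card C).eq_zero_or_pos
  · rw [hC]
    simp only [Nat.cast_zero, mul_zero]
    positivity
  have hTS : S \ D ⊆ S := Finset.sdiff_subset
  have hD : #D = #(S \ (S \ D)) + 1 := by
    have : D = insert v (S \ (S \ D)) := by
      ext x
      have := @hDS x
      by_cases hxv : x = v <;> simp_all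
    conv_lhs => rw [this]
    exact Finset.card_insert_of_notMem (by simp [hv])
  have hmul := card_filter_mem_mul_pow_le (T := S \ D) hlocal Finset.sdiff_disjoint hA
  have hsub : #{f ∈ F S | f ∈ A} ≤ #{f ∈ F (S \ D) | f ∈ A} :=
    Finset.card_le_card (Finset.filter_subset_filter _ (colouringsAvoidingWithin_antitone hTS))
  have hpow : (#{f ∈ F S | f ∈ A} : ℝ) * Fintype.card C ^ #D ≤ #(F (S \ D)) := by
    exact_mod_cast (Nat.mul_le_mul_right _ hsub).trans hmul
  set k := #(S \ (S \ D))
  have hC' : (0 : ℝ) < Fintype.card C := by exact_mod_cast hC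
  rw [hD, pow_succ, div_mul_cancel_right₀ hβ.ne', ← div_eq_mul_inv, le_div_iff₀ (by positivity)]
  refine le_of_mul_le_mul_left ?_ (pow_pos hC' k)
  calc (Fintype.card C : ℝ) ^ k * (#{f ∈ F S | f ∈ A} * Fintype.card C * β ^ k)
      = β ^ k * (#{f ∈ F S | f ∈ A} * Fintype.card C ^ #D) := by rw [hD]; ring
    _ ≤ β ^ k * #(F (S \ D)) := by gcongr
    _ ≤ (Fintype.card C : ℝ) ^ k * #(F S) := hchain _ hTS

open Classical in
theorem card_colouringsAvoidingWithin_le (v : V) :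
    #(colouringsAvoidingWithin s supp bad S) ≤
      #(colouringsAvoidingWithin s supp bad (insert v S)) +
        ∑ e ∈ s with v ∈ supp e ∧ supp e ⊆ insert v S,
          #{f ∈ colouringsAvoidingWithin s supp bad S | f ∈ bad e} := by
  refine (Finset.card_le_card fun f hf => ?_).trans
    ((Finset.card_union_le _ _).trans (Nat.add_le_add_left Finset.card_biUnion_le _))
  by_contra hcover
  simp only [Finset.mem_union, Finset.mem_biUnion, Finset.mem_filter, mem_colouringsAvoidingWithin,
    not_or, not_forall, not_not] at hf hcover
  obtain ⟨⟨e, he, heS, hbad⟩, hcover⟩ := hcover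
  refine hcover ⟨e, ⟨he, by_contra fun hve => ?_, heS⟩, hf, hbad⟩
  exact hf e he ((Finset.subset_insert_iff_of_notMem hve).1 heS) hbad

variable {β : ℝ} {det : ι → V → Finset V}

-- Rosenfeld's counting argument, in place of the Lovász local lemma.
theorem mul_card_colouringsAvoidingWithin_le (hβ : 0 < β)
    (hlocal : ∀ e ∈ s, DependsOn (· ∈ bad e) (supp e : Set V))
    (hmem : ∀ e ∈ s, ∀ v ∈ supp e, v ∈ det e v) (hsub : ∀ e ∈ s, ∀ v ∈ supp e, det e v ⊆ supp e)
    (hdet : ∀ e ∈ s, ∀ v ∈ supp e, IsDeterminedOn (bad e) (det e v))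
    (hsum : ∀ v, ∑ e ∈ s with v ∈ supp e, β / β ^ #(det e v) ≤ Fintype.card C - β)
    (S : Finset V) (v : V) (hv : v ∉ S) :
    β * #(colouringsAvoidingWithin s supp bad S) ≤
      Fintype.card C * #(colouringsAvoidingWithin s supp bad (insert v S)) := by
  classical
  induction S using Finset.strongInduction generalizing v with
  | H S ih =>
  set F := colouringsAvoidingWithin s supp bad
  have hchain (T : Finset V) (hT : T ⊆ S) :
      β ^ #(S \ T) * #(F T) ≤ (Fintype.card C : ℝ) ^ #(S \ T) * #(F S) :=
    pow_card_sdiff_mul_le (F := fun T => (#(F T) : ℝ)) hβ.le (Nat.cast_nonneg _) ih hT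
  have hbad : (∑ e ∈ s with v ∈ supp e ∧ supp e ⊆ insert v S, (#{f ∈ F S | f ∈ bad e} : ℝ)) *
      Fintype.card C ≤ #(F S) * (Fintype.card C - β) := by
    rw [Finset.sum_mul]
    calc ∑ e ∈ s with v ∈ supp e ∧ supp e ⊆ insert v S,
          (#{f ∈ F S | f ∈ bad e} : ℝ) * Fintype.card C
        ≤ ∑ e ∈ s with v ∈ supp e ∧ supp e ⊆ insert v S, #(F S) * (β / β ^ #(det e v)) := by
          refine Finset.sum_le_sum fun e he => ?_
          obtain ⟨he, hve, heS⟩ := Finset.mem_filter.1 he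
          exact card_filter_mem_mul_card_le hβ hlocal hchain hv (hmem e he v hve)
            ((hsub e he v hve).trans heS) (hdet e he v hve)
      _ ≤ ∑ e ∈ s with v ∈ supp e, #(F S) * (β / β ^ #(det e v)) :=
          Finset.sum_le_sum_of_subset_of_nonneg
            (Finset.monotone_filter_right _ fun e _ he => he.1) fun e _ _ => by positivity
      _ ≤ #(F S) * (Fintype.card C - β) := by
          rw [← Finset.mul_sum]
          gcongr
          exact hsum v
  have hcard : (#(F S) : ℝ) ≤ #(F (insert v S)) +
      ∑ e ∈ s with v ∈ supp e ∧ supp e ⊆ insert v S, (#{f ∈ F S | f ∈ bad e} : ℝ) := by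
    exact_mod_cast card_colouringsAvoidingWithin_le v
  have := mul_le_mul_of_nonneg_right hcard (Nat.cast_nonneg (α := ℝ) (Fintype.card C))
  linarith

end Counting

theorem exists_forall_notMem_of_sum_le {ι V C : Type*} [Finite V] [DecidableEq V] [Fintype C]
    [Nonempty C] {s : Finset ι} {supp : ι → Finset V} {bad : ι → Set (V → C)} {β : ℝ}
    {det : ι → V → Finset V} (hβ : 0 < β)
    (hne : ∀ e ∈ s, (supp e).Nonempty)
    (hlocal : ∀ e ∈ s, DependsOn (· ∈ bad e) (supp e : Set V))
    (hmem : ∀ e ∈ s, ∀ v ∈ supp e, v ∈ det e v) (hsub : ∀ e ∈ s, ∀ v ∈ supp e, det e v ⊆ supp e)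
    (hdet : ∀ e ∈ s, ∀ v ∈ supp e, IsDeterminedOn (bad e) (det e v))
    (hsum : ∀ v, ∑ e ∈ s with v ∈ supp e, β / β ^ #(det e v) ≤ Fintype.card C - β) :
    ∃ f : V → C, ∀ e ∈ s, f ∉ bad e := by
  have := Fintype.ofFinite V
  have hpos (S : Finset V) : 0 < #(colouringsAvoidingWithin s supp bad S) := by
    induction S using Finset.induction_on with
    | empty =>
      refine Finset.card_pos.2 ⟨fun _ => Classical.arbitrary C, ?_⟩
      rw [mem_colouringsAvoidingWithin]
      exact fun e he h => absurd (Finset.subset_empty.1 h) (hne e he).ne_empty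
    | insert v S hv ih =>
      have h := mul_card_colouringsAvoidingWithin_le hβ hlocal hmem hsub hdet hsum S v hv
      have : 0 < β * #(colouringsAvoidingWithin s supp bad S) := by positivity
      exact_mod_cast pos_of_mul_pos_right (this.trans_le h) (Nat.cast_nonneg _)
  obtain ⟨f, hf⟩ := Finset.card_pos.1 (hpos Finset.univ)
  exact ⟨f, fun e he => mem_colouringsAvoidingWithin.1 hf e he (Finset.subset_univ _)⟩

theorem exists_isDeterminedOn_of_forall_exists_eq {V C : Type*}
    {A : Set (V → C)} {X : Finset V} (hA : ∀ x ∈ X, ∃ y ∈ X, y ≠ x ∧ ∀ f ∈ A, f x = f y)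
    {v : V} (hv : v ∈ X) :
    ∃ D ⊆ X, v ∈ D ∧ #X ≤ 2 * #D ∧ IsDeterminedOn A D := by
  classical
  let r : Setoid V :=
    { r x y := ∀ f ∈ A, f x = f y
      iseqv := ⟨fun _ _ _ => rfl, fun h f hf => (h f hf).symm,
        fun h h' f hf => (h f hf).trans (h' f hf)⟩ }
  choose! mate hmateX hmate_ne hmate using hA
  let rep (x : V) : V := Function.update Quotient.out ⟦v⟧ (mate v) (⟦x⟧ : Quotient r)
  have rep_eq {x y : V} (h : r x y) : rep x = rep y := by
    simp only [rep, Quotient.sound h]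
  have hrep (x : V) : r x (rep x) := by
    by_cases h : (⟦x⟧ : Quotient r) = ⟦v⟧
    · simp only [rep, h, Function.update_self]
      exact r.trans (Quotient.exact h) (hmate v hv)
    · simp only [rep, ne_eq, h, not_false_eq_true, Function.update_of_ne]
      exact r.symm (Quotient.mk_out x)
  refine ⟨{x ∈ X | rep x ≠ x}, Finset.filter_subset _ _, ?_, ?_, ?_⟩
  · have : rep v = mate v := Function.update_self ..
    rw [Finset.mem_filter, this]
    exact ⟨hv, hmate_ne v hv⟩
  · have hle : #{x ∈ X | ¬ rep x ≠ x} ≤ #{x ∈ X | rep x ≠ x} := by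
      refine Finset.card_le_card_of_injOn mate (fun x hx => ?_) fun x hx y hy hxy => ?_
      · simp only [Finset.coe_filter, Set.mem_ofPred_eq, not_not] at hx ⊢
        rw [← rep_eq (hmate x hx.1), hx.2]
        exact ⟨hmateX x hx.1, (hmate_ne x hx.1).symm⟩
      · simp only [Finset.coe_filter, Set.mem_ofPred_eq, not_not] at hx hy
        rw [← hx.2, ← hy.2, rep_eq (hmate x hx.1), rep_eq (hmate y hy.1), hxy]
    have := Finset.card_filter_add_card_filter_not (s := X) (fun x => rep x ≠ x)
    lia
  · intro f hf f' hf' h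
    funext x
    have hfix : rep (rep x) = rep x := (rep_eq (hrep x)).symm
    rw [hrep x f hf, hrep x f' hf', h (rep x) (by simp [hfix])]

section Sequences

variable {V C : Type*}

/-- The first `n` terms of the sequence `w` form a walk in `G`. -/
def IsWalkSeq (G : SimpleGraph V) (n : ℕ) (w : ℕ → V) : Prop :=
  ∀ i, i + 1 < n → G.Adj (w i) (w (i + 1))

/-- The first `2 * t` terms of the sequence `w` are repetitively coloured by `f`. -/
def IsRepetitiveSeq (f : V → C) (t : ℕ) (w : ℕ → V) : Prop :=
  ∀ i < t, f (w i) = f (w (t + i))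

/-- The set of the first `n` terms of the sequence `w`. -/
def vertices [DecidableEq V] (n : ℕ) (w : ℕ → V) : Finset V :=
  (Finset.range n).image w

open Classical in
/-- The first `2 * t` terms of `w` form a walk in `G` whose length is at most `H` times its order
and whose two halves disagree at every position. -/
structure IsShortNowhereBoring (G : SimpleGraph V) (H t : ℕ) (w : ℕ → V) : Prop where
  pos : 0 < t
  isWalkSeq : IsWalkSeq G (2 * t) w
  ne : ∀ i < t, w i ≠ w (t + i)
  length_le : 2 * t ≤ H * #(vertices (2 * t) w)

/-- No walk of length at most `H` times its order whose halves disagree everywhere is repetitively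
coloured by `f`. -/
def AvoidsShort (G : SimpleGraph V) (H : ℕ) (f : V → C) : Prop :=
  ∀ t w, IsShortNowhereBoring G H t w → ¬ IsRepetitiveSeq f t w

theorem mem_vertices [DecidableEq V] {n : ℕ} {w : ℕ → V} {v : V} :
    v ∈ vertices n w ↔ ∃ i < n, w i = v := by
  simp [vertices]

theorem apply_mem_vertices [DecidableEq V] {n i : ℕ} {w : ℕ → V} (hi : i < n) :
    w i ∈ vertices n w :=
  mem_vertices.2 ⟨i, hi, rfl⟩

theorem vertices_congr [DecidableEq V] {n : ℕ} {w w' : ℕ → V} (h : ∀ i < n, w i = w' i) :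
    vertices n w = vertices n w' :=
  Finset.image_congr fun i hi => h i (Finset.mem_range.1 hi)

theorem card_vertices_of_injOn [DecidableEq V] {n : ℕ} {w : ℕ → V}
    (h : Set.InjOn w (Set.Iio n)) : #(vertices n w) = n := by
  rw [vertices, Finset.card_image_of_injOn (by simpa using h), Finset.card_range]

variable {G : SimpleGraph V} {H t : ℕ} {w w' : ℕ → V} {f : V → C}

theorem IsShortNowhereBoring.congr (hw : IsShortNowhereBoring G H t w)
    (h : ∀ i < 2 * t, w i = w' i) : IsShortNowhereBoring G H t w' where
  pos := hw.pos
  isWalkSeq i hi := by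
    rw [← h i (by lia), ← h (i + 1) hi]
    exact hw.isWalkSeq i hi
  ne i hi := by
    rw [← h i (by lia), ← h (t + i) (by lia)]
    exact hw.ne i hi
  length_le := by
    classical
    rw [← vertices_congr h]
    exact hw.length_le

theorem IsShortNowhereBoring.of_injOn (hH : 0 < H) (ht : 0 < t) (hw : IsWalkSeq G (2 * t) w)
    (hinj : Set.InjOn w (Set.Iio (2 * t))) : IsShortNowhereBoring G H t w where
  pos := ht
  isWalkSeq := hw
  ne i hi heq := by
    have := hinj (Set.mem_Iio.2 (by lia)) (Set.mem_Iio.2 (by lia)) heq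
    lia
  length_le := by
    classical
    rw [card_vertices_of_injOn hinj]
    exact Nat.le_mul_of_pos_left _ hH

theorem IsRepetitiveSeq.congr (hw : IsRepetitiveSeq f t w) (h : ∀ i < 2 * t, w i = w' i) :
    IsRepetitiveSeq f t w' := by
  intro i hi
  rw [← h i (by lia), ← h (t + i) (by lia)]
  exact hw i hi

theorem AvoidsShort.mono_left {G' : SimpleGraph V} (hG : G ≤ G') (hf : AvoidsShort G' H f) :
    AvoidsShort G H f :=
  fun t w hw => hf t w { hw with isWalkSeq := fun i hi => hG (hw.isWalkSeq i hi) }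

theorem dependsOn_isRepetitiveSeq [DecidableEq V] (t : ℕ) (w : ℕ → V) :
    DependsOn (fun f : V → C => IsRepetitiveSeq f t w) (vertices (2 * t) w : Set V) := by
  intro f f' h
  refine propext (forall₂_congr fun i hi => ?_)
  rw [h _ (apply_mem_vertices (by lia)), h _ (apply_mem_vertices (by lia))]

theorem exists_isDeterminedOn_isRepetitiveSeq [DecidableEq V]
    (hw : ∀ i < t, w i ≠ w (t + i)) {v : V} (hv : v ∈ vertices (2 * t) w) :
    ∃ D ⊆ vertices (2 * t) w, v ∈ D ∧ #(vertices (2 * t) w) ≤ 2 * #D ∧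
      IsDeterminedOn {f : V → C | IsRepetitiveSeq f t w} D := by
  refine exists_isDeterminedOn_of_forall_exists_eq (fun x hx => ?_) hv
  obtain ⟨i, hi, rfl⟩ := mem_vertices.1 hx
  obtain hit | ⟨j, rfl⟩ := (lt_or_ge i t).imp_right Nat.exists_eq_add_of_le
  · exact ⟨w (t + i), apply_mem_vertices (by lia), (hw i hit).symm, fun f hf => hf i hit⟩
  · exact ⟨w j, apply_mem_vertices (by lia), hw j (by lia), fun f hf => (hf j (by lia)).symm⟩

end Sequences

section CountingWalks

variable {V : Type*} [Fintype V] {G : SimpleGraph V} [DecidableRel G.Adj] {D : ℕ}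

theorem card_le_maxDegree_mul_card {α β : Type*} {S : Finset α} {T : Finset β}
    (hD : G.maxDegree ≤ D) (π : α → β) (base : β → V) (tip : α → V) (hπ : ∀ x ∈ S, π x ∈ T)
    (hadj : ∀ x ∈ S, G.Adj (base (π x)) (tip x))
    (hinj : ∀ x ∈ S, ∀ x' ∈ S, π x = π x' → tip x = tip x' → x = x') : #S ≤ D * #T := by
  classical
  refine Finset.card_le_mul_card_image_of_maps_to hπ D fun y _ => ?_
  calc #{x ∈ S | π x = y} ≤ #(G.neighborFinset (base y)) := by
        refine Finset.card_le_card_of_injOn tip (fun x hx => ?_) fun x hx x' hx' h => ?_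
        · obtain ⟨hxS, rfl⟩ := Finset.mem_filter.1 (Finset.mem_coe.1 hx)
          exact (G.mem_neighborFinset _ _).2 (hadj x hxS)
        · obtain ⟨hx, hxy⟩ := Finset.mem_filter.1 hx
          obtain ⟨hx', hxy'⟩ := Finset.mem_filter.1 hx'
          exact hinj x hx x' hx' (hxy.trans hxy'.symm) h
    _ ≤ D := (G.degree_le_maxDegree _).trans hD

open Classical in
theorem card_walks_through_le (hD : G.maxDegree ≤ D) (v : V) (n : ℕ) (p : Fin (n + 1)) :
    #{x : Fin (n + 1) → V | (∀ i : Fin n, G.Adj (x i.castSucc) (x i.succ)) ∧ x p = v} ≤ D ^ n := by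
  induction n with
  | zero =>
    rw [pow_zero, Finset.card_le_one]
    intro x hx y hy
    simp only [Finset.mem_filter, Finset.mem_univ, true_and] at hx hy
    funext i
    obtain rfl : i = p := Fin.subsingleton_one.elim i p
    rw [hx.2, hy.2]
  | succ n ih =>
    rw [pow_succ']
    obtain rfl | ⟨q, rfl⟩ := p.eq_zero_or_eq_succ
    · refine (card_le_maxDegree_mul_card hD Fin.init (fun y => y (Fin.last n))
        (fun x => x (Fin.last (n + 1))) (fun x hx => ?_) (fun x hx => ?_)
        fun x _ x' _ hinit hlast => ?_).trans (Nat.mul_le_mul_left D (ih 0))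
      · simp only [Finset.mem_filter, Finset.mem_univ, true_and] at hx ⊢
        exact ⟨fun i => hx.1 i.castSucc, hx.2⟩
      · exact (Finset.mem_filter.1 hx).2.1 (Fin.last n)
      · rw [← Fin.snoc_init_self x, ← Fin.snoc_init_self x', hinit, hlast]
    · refine (card_le_maxDegree_mul_card hD Fin.tail (fun y => y 0) (fun x => x 0)
        (fun x hx => ?_) (fun x hx => ?_)
        fun x _ x' _ htail hhead => ?_).trans (Nat.mul_le_mul_left D (ih q))
      · simp only [Finset.mem_filter, Finset.mem_univ, true_and] at hx ⊢
        exact ⟨fun i => hx.1 i.succ, hx.2⟩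
      · exact ((Finset.mem_filter.1 hx).2.1 0).symm
      · rw [← Fin.cons_self_tail x, ← Fin.cons_self_tail x', htail, hhead]

end CountingWalks

theorem sum_two_mul_mul_pow_div_pow_le (D T : ℕ) :
    ∑ t ∈ Finset.range T, (2 * t * D ^ (2 * t - 1) : ℝ) / (8 * (D + 1) ^ 2) ^ t ≤ 1 := by
  have hterm (t : ℕ) :
      (2 * t * D ^ (2 * t - 1) : ℝ) / (8 * (D + 1) ^ 2) ^ t ≤ (1 / 2) ^ t * (1 / 2) := by
    have h4 : 4 * t ≤ 4 ^ t := by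
      induction t with
      | zero => simp
      | succ t ih =>
        have := Nat.one_le_pow t 4 (by simp)
        rw [pow_succ]
        lia
    have hpow : (D : ℝ) ^ (2 * t - 1) ≤ (D + 1) ^ (2 * t) :=
      calc (D : ℝ) ^ (2 * t - 1) ≤ (D + 1) ^ (2 * t - 1) := by gcongr; linarith
        _ ≤ (D + 1) ^ (2 * t) := pow_le_pow_right₀ (by linarith [D.cast_nonneg (α := ℝ)]) (by lia)
    rw [div_le_iff₀ (by positivity)]
    calc (2 * t * D ^ (2 * t - 1) : ℝ) ≤ 2 * t * (D + 1) ^ (2 * t) := by gcongr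
      _ = 1 / 2 * (4 * t : ℕ) * (D + 1) ^ (2 * t) := by push_cast; ring
      _ ≤ 1 / 2 * (4 ^ t : ℕ) * (D + 1) ^ (2 * t) := by gcongr
      _ = (1 / 2) ^ t * (1 / 2) * (8 * (D + 1) ^ 2) ^ t := by
        rw [mul_pow, ← pow_mul, show (8 : ℝ) = 2 * 4 by norm_num, mul_pow]
        push_cast
        rw [one_div_pow]
        field_simp
  calc ∑ t ∈ Finset.range T, (2 * t * D ^ (2 * t - 1) : ℝ) / (8 * (D + 1) ^ 2) ^ t
      ≤ ∑ t ∈ Finset.range T, (1 / 2 : ℝ) ^ t * (1 / 2) := Finset.sum_le_sum fun t _ => hterm t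
    _ = (∑ t ∈ Finset.range T, (1 / 2 : ℝ) ^ t) * (1 / 2) := by rw [Finset.sum_mul]
    _ ≤ 1 := by linarith [sum_geometric_two_le T]

section Avoiding

variable {V : Type*}

/-- The extension of a finite sequence `x` to an infinite one by a constant, which turns walks with
a given number of vertices into a finite type. -/
noncomputable def extendSeq {n : ℕ} (v₀ : V) (x : Fin n → V) : ℕ → V :=
  Function.extend Fin.val x fun _ => v₀

theorem extendSeq_apply {n i : ℕ} (v₀ : V) (x : Fin n → V) (hi : i < n) :
    extendSeq v₀ x i = x ⟨i, hi⟩ :=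
  Fin.val_injective.extend_apply x _ ⟨i, hi⟩

variable [Fintype V] {G : SimpleGraph V} {D H : ℕ}

theorem IsShortNowhereBoring.le_mul_card {t : ℕ} {w : ℕ → V} (hw : IsShortNowhereBoring G H t w) :
    t ≤ H * Fintype.card V := by
  classical
  have := hw.length_le.trans (Nat.mul_le_mul_left H (Finset.card_le_univ _))
  lia

open Classical in
/-- The events to be avoided: all short nowhere boring walks of `G`, encoded by their number of
vertices and their vertices. -/
noncomputable def shortWalks (G : SimpleGraph V) (H : ℕ) (v₀ : V) :
    Finset (Σ t : ℕ, Fin (2 * t) → V) :=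
  (Finset.range (H * Fintype.card V + 1)).sigma fun t =>
    {x | IsShortNowhereBoring G H t (extendSeq v₀ x)}

theorem mem_shortWalks {v₀ : V} {e : Σ t : ℕ, Fin (2 * t) → V} :
    e ∈ shortWalks G H v₀ ↔ IsShortNowhereBoring G H e.1 (extendSeq v₀ e.2) := by
  simp only [shortWalks, Finset.mem_sigma, Finset.mem_range, Finset.mem_filter, Finset.mem_univ,
    true_and]
  exact ⟨And.right, fun h => ⟨Nat.lt_succ_of_le h.le_mul_card, h⟩⟩

variable [DecidableRel G.Adj]

open Classical in
theorem card_filter_isWalkSeq_le (hD : G.maxDegree ≤ D) (v v₀ : V) (n : ℕ) :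
    #{x : Fin n → V | IsWalkSeq G n (extendSeq v₀ x) ∧ v ∈ vertices n (extendSeq v₀ x)} ≤
      n * D ^ (n - 1) := by
  cases n with
  | zero => simp [vertices]
  | succ n =>
    calc #{x : Fin (n + 1) → V | _} ≤ #((Finset.univ : Finset (Fin (n + 1))).biUnion fun p =>
          {x : Fin (n + 1) → V | (∀ i : Fin n, G.Adj (x i.castSucc) (x i.succ)) ∧ x p = v}) := by
          refine Finset.card_le_card fun x hx => ?_
          simp only [Finset.mem_filter, Finset.mem_univ, true_and, mem_vertices,
            Finset.mem_biUnion] at hx ⊢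
          obtain ⟨hx, p, hp, rfl⟩ := hx
          refine ⟨⟨p, hp⟩, fun i => ?_, (extendSeq_apply v₀ x hp).symm⟩
          have := hx i (by lia)
          rwa [extendSeq_apply v₀ x (by lia), extendSeq_apply v₀ x (by lia)] at this
      _ ≤ #(Finset.univ : Finset (Fin (n + 1))) * D ^ n :=
          Finset.card_biUnion_le_card_mul _ _ _ fun p _ => card_walks_through_le hD v n p
      _ = (n + 1) * D ^ n := by simp

open Classical in
theorem sum_one_div_pow_le (hD : G.maxDegree ≤ D) {B : ℝ} (hB : 1 ≤ B) (v v₀ : V) (t : ℕ)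
    (d : (Fin (2 * t) → V) → ℕ)
    (hd : ∀ x, IsShortNowhereBoring G H t (extendSeq v₀ x) →
      v ∈ vertices (2 * t) (extendSeq v₀ x) → #(vertices (2 * t) (extendSeq v₀ x)) ≤ 2 * d x) :
    ∑ x with IsShortNowhereBoring G H t (extendSeq v₀ x) ∧
      v ∈ vertices (2 * t) (extendSeq v₀ x), 1 / (B ^ H) ^ d x ≤
        (2 * t * D ^ (2 * t - 1) : ℝ) / B ^ t := by
  set X : Finset (Fin (2 * t) → V) := {x | IsShortNowhereBoring G H t (extendSeq v₀ x) ∧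
    v ∈ vertices (2 * t) (extendSeq v₀ x)}
  have hcard : #X ≤ 2 * t * D ^ (2 * t - 1) :=
    (Finset.card_le_card (Finset.monotone_filter_right _ fun x _ hx =>
      And.imp_left IsShortNowhereBoring.isWalkSeq hx)).trans (card_filter_isWalkSeq_le hD v v₀ _)
  calc ∑ x ∈ X, 1 / (B ^ H) ^ d x ≤ ∑ x ∈ X, 1 / B ^ t := by
        refine Finset.sum_le_sum fun x hx => ?_
        obtain ⟨hw, hv⟩ := (Finset.mem_filter.1 hx).2
        have ht : t ≤ H * d x := by
          have := hw.length_le.trans (Nat.mul_le_mul_left H (hd x hw hv))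
          lia
        rw [← pow_mul]
        gcongr
    _ = #X * (1 / B ^ t) := by rw [Finset.sum_const, nsmul_eq_mul]
    _ ≤ (2 * t * D ^ (2 * t - 1) : ℕ) * (1 / B ^ t) := by gcongr
    _ = (2 * t * D ^ (2 * t - 1) : ℝ) / B ^ t := by push_cast; ring

open Classical in
theorem sum_shortWalks_one_div_pow_le (hD : G.maxDegree ≤ D) (v v₀ : V)
    (d : (Σ t : ℕ, Fin (2 * t) → V) → ℕ)
    (hd : ∀ e ∈ shortWalks G H v₀, v ∈ vertices (2 * e.1) (extendSeq v₀ e.2) →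
      #(vertices (2 * e.1) (extendSeq v₀ e.2)) ≤ 2 * d e) :
    ∑ e ∈ shortWalks G H v₀ with v ∈ vertices (2 * e.1) (extendSeq v₀ e.2),
      (1 : ℝ) / ((8 * (D + 1) ^ 2) ^ H) ^ d e ≤ 1 := by
  have hB : (1 : ℝ) ≤ 8 * (D + 1) ^ 2 := by nlinarith [D.cast_nonneg (α := ℝ)]
  rw [Finset.sum_filter, shortWalks, Finset.sum_sigma]
  refine (Finset.sum_le_sum fun t _ => ?_).trans (sum_two_mul_mul_pow_div_pow_le D _)
  rw [← Finset.sum_filter, Finset.filter_filter]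
  exact sum_one_div_pow_le hD hB v v₀ t _ fun x hx hv => hd ⟨t, x⟩ (mem_shortWalks.2 hx) hv

theorem exists_avoidsShort {C : Type*} [Fintype C] (hD : G.maxDegree ≤ D)
    (hC : 2 * (8 * (D + 1) ^ 2) ^ H ≤ Fintype.card C) : ∃ f : V → C, AvoidsShort G H f := by
  classical
  have : Nonempty C := Fintype.card_pos_iff.1 ((by positivity : 0 < _).trans_le hC)
  obtain _ | ⟨⟨v₀⟩⟩ := isEmpty_or_nonempty V
  · exact ⟨isEmptyElim, fun _ w => isEmptyElim (w 0)⟩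
  choose! det hsub hmem hcard hdet using
    fun e (he : e ∈ shortWalks G H v₀) v (hv : v ∈ vertices (2 * e.1) (extendSeq v₀ e.2)) =>
      exists_isDeterminedOn_isRepetitiveSeq (C := C) (mem_shortWalks.1 he).ne hv
  set β : ℝ := (8 * (D + 1) ^ 2) ^ H
  have hβ : 0 < β := by positivity
  have hβC : 2 * β ≤ Fintype.card C := by simp only [β]; exact_mod_cast hC
  have hsum (v : V) :
      ∑ e ∈ shortWalks G H v₀ with v ∈ vertices (2 * e.1) (extendSeq v₀ e.2), β / β ^ #(det e v) ≤
        Fintype.card C - β := by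
    simp only [← mul_one_div β, ← Finset.mul_sum]
    have := sum_shortWalks_one_div_pow_le hD v v₀ (fun e => #(det e v)) (hcard · · v)
    linarith [mul_le_mul_of_nonneg_left this hβ.le]
  obtain ⟨f, hf⟩ := exists_forall_notMem_of_sum_le hβ
    (fun e he => ⟨_, apply_mem_vertices (i := 0) (by have := (mem_shortWalks.1 he).pos; lia)⟩)
    (fun e _ => dependsOn_isRepetitiveSeq e.1 (extendSeq v₀ e.2)) hmem hsub hdet hsum
  refine ⟨f, fun t w hw hrep => ?_⟩
  have hext : ∀ i < 2 * t, w i = extendSeq v₀ (fun i : Fin (2 * t) => w i) i :=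
    fun i hi => (extendSeq_apply v₀ (fun i : Fin (2 * t) => w i) hi).symm
  exact hf ⟨t, fun i => w i⟩ (mem_shortWalks.2 (hw.congr hext)) (hrep.congr hext)

end Avoiding

section SquarefreeWords

variable {C : Type*}

/-- No two consecutive blocks of the word `τ 0, …, τ (n - 1)` are equal. -/
def IsSquarefreeWord (n : ℕ) (τ : ℕ → C) : Prop :=
  ∀ a k, 0 < k → a + 2 * k ≤ n → ¬ ∀ i < k, τ (a + i) = τ (a + k + i)

theorem maxDegree_pathGraph_le (n : ℕ) [DecidableRel (SimpleGraph.pathGraph n).Adj] :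
    (SimpleGraph.pathGraph n).maxDegree ≤ 2 := by
  refine SimpleGraph.maxDegree_le_of_forall_degree_le _ _ fun v => ?_
  calc (SimpleGraph.pathGraph n).degree v
      ≤ #({(v : ℕ) + 1, (v : ℕ) - 1} : Finset ℕ) := by
        refine Finset.card_le_card_of_injOn Fin.val (fun w hw => ?_) Fin.val_injective.injOn
        rw [Finset.mem_coe, SimpleGraph.mem_neighborFinset, SimpleGraph.pathGraph_adj] at hw
        simp only [Finset.coe_insert, Finset.coe_singleton, Set.mem_insert_iff,
          Set.mem_singleton_iff]
        lia
    _ ≤ 2 := Finset.card_le_two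

theorem exists_isSquarefreeWord [Fintype C] (hC : 144 ≤ Fintype.card C) (n : ℕ) :
    ∃ τ : ℕ → C, IsSquarefreeWord n τ := by
  classical
  obtain ⟨f, hf⟩ := exists_avoidsShort (H := 1) (maxDegree_pathGraph_le (n + 1)) hC
  refine ⟨fun i => f (Fin.ofNat (n + 1) i), fun a k hk hak hsq => ?_⟩
  have hval (i : ℕ) (hi : i < 2 * k) : (Fin.ofNat (n + 1) (a + i)).val = a + i :=
    Nat.mod_eq_of_lt (by lia)
  have hinj : Set.InjOn (fun i => Fin.ofNat (n + 1) (a + i)) (Set.Iio (2 * k)) := by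
    intro i hi j hj hij
    have := congrArg Fin.val hij
    rw [hval i hi, hval j hj] at this
    lia
  have hwalk : IsWalkSeq (SimpleGraph.pathGraph (n + 1)) (2 * k)
      fun i => Fin.ofNat (n + 1) (a + i) := fun i hi => by
    rw [SimpleGraph.pathGraph_adj, hval i (by lia), hval (i + 1) hi]
    exact .inl (add_assoc a i 1)
  exact hf k _ (.of_injOn one_pos hk hwalk hinj) fun i hi => by
    simpa only [add_assoc] using hsq i hi

end SquarefreeWords

section DistanceTwo

variable {V C : Type*} {G : SimpleGraph V} {f : V → C}

theorem square_adj {v w : V} :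
    (square G).Adj v w ↔ v ≠ w ∧ (G.Adj v w ∨ ∃ x, G.Adj v x ∧ G.Adj x w) := by
  refine and_congr_right fun hne => ⟨fun hd => ?_, ?_⟩
  · have htop : G.edist v w ≠ ⊤ := fun h => absurd (h ▸ hd) (by decide)
    obtain ⟨p, hp⟩ := SimpleGraph.exists_walk_of_edist_ne_top htop
    have hlen : p.length ≤ 2 := by exact_mod_cast hp ▸ hd
    match p, hlen with
    | .nil, _ => exact absurd rfl hne
    | .cons h .nil, _ => exact .inl h
    | .cons h (.cons h' .nil), _ => exact .inr ⟨_, h, h'⟩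
    | .cons _ (.cons _ (.cons _ _)), hlen => simp at hlen
  · rintro (h | ⟨x, h, h'⟩)
    · exact (SimpleGraph.edist_le h.toWalk).trans (by simp)
    · exact (SimpleGraph.edist_le (.cons h h'.toWalk)).trans (by simp [one_add_one_eq_two])

theorem le_square : G ≤ square G :=
  fun _ _ h => square_adj.2 ⟨h.ne, .inl h⟩

theorem isDistanceTwoColouring_iff : IsDistanceTwoColouring G f ↔
    (∀ v w, G.Adj v w → f v ≠ f w) ∧ ∀ v, Set.InjOn f (G.neighborSet v) := by
  simp only [IsDistanceTwoColouring, square_adj]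
  refine ⟨fun h => ⟨fun v w hvw => h v w ⟨hvw.ne, .inl hvw⟩, fun v x hx y hy hxy => ?_⟩, ?_⟩
  · by_contra hne
    exact h x y ⟨hne, .inr ⟨v, hx.symm, hy⟩⟩ hxy
  · rintro ⟨hproper, hinj⟩ v w ⟨hne, hvw | ⟨x, hvx, hxw⟩⟩ heq
    · exact hproper v w hvw heq
    · exact hne (hinj x hvx.symm hxw heq)

theorem maxDegree_square_le [Fintype V] [DecidableRel G.Adj] [DecidableRel (square G).Adj] {D : ℕ}
    (hD : G.maxDegree ≤ D) : (square G).maxDegree ≤ D + D * D := by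
  classical
  refine SimpleGraph.maxDegree_le_of_forall_degree_le _ _ fun v => ?_
  have hsub : (square G).neighborFinset v ⊆
      G.neighborFinset v ∪ (G.neighborFinset v).biUnion fun x => G.neighborFinset x := by
    intro w hw
    simpa [square_adj] using ((square_adj.1 ((SimpleGraph.mem_neighborFinset _ _ _).1 hw)).2)
  have hdeg (x : V) : #(G.neighborFinset x) ≤ D := (G.degree_le_maxDegree x).trans hD
  calc (square G).degree v
      ≤ #(G.neighborFinset v) + #((G.neighborFinset v).biUnion fun x => G.neighborFinset x) :=
        (Finset.card_le_card hsub).trans (Finset.card_union_le _ _)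
    _ ≤ #(G.neighborFinset v) + #(G.neighborFinset v) * D :=
        Nat.add_le_add_left (Finset.card_biUnion_le_card_mul _ _ _ fun x _ => hdeg x) _
    _ ≤ D + D * D := Nat.add_le_add (hdeg v) (Nat.mul_le_mul_right D (hdeg v))

theorem AvoidsShort.ne_of_adj {H : ℕ} (hH : 0 < H) (hf : AvoidsShort G H f) {v w : V}
    (hvw : G.Adj v w) : f v ≠ f w := by
  let u : ℕ → V := fun i => if i = 0 then v else w
  have hu : Set.InjOn u (Set.Iio (2 * 1)) := by
    intro i hi j hj hij
    have hne := hvw.ne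
    simp only [Set.mem_Iio] at hi hj
    grind
  have hwalk : IsWalkSeq G (2 * 1) u := fun i hi => by
    obtain rfl : i = 0 := by lia
    exact hvw
  exact fun heq => hf 1 u (.of_injOn hH one_pos hwalk hu) fun i hi => by
    obtain rfl : i = 0 := by lia
    exact heq

theorem exists_isDistanceTwoColouring_avoidsShort [Fintype V] [DecidableRel G.Adj] [Fintype C]
    {D H : ℕ} (hH : 0 < H) (hD : G.maxDegree ≤ D)
    (hC : 2 * (8 * (D + D * D + 1) ^ 2) ^ H ≤ Fintype.card C) :
    ∃ f : V → C, IsDistanceTwoColouring G f ∧ AvoidsShort G H f := by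
  classical
  obtain ⟨f, hf⟩ := exists_avoidsShort (maxDegree_square_le hD) hC
  exact ⟨f, fun v w hvw => hf.ne_of_adj hH hvw, hf.mono_left le_square⟩

end DistanceTwo

section Subdivision

variable {V K B : Type*} {N : ℕ}

/-- The vertices of the graph obtained by subdividing each edge `N` times. The vertex `inl v` is
the original vertex `v`; of the vertices `inr (v, w, d)` only those with `1 ≤ d ≤ N` and `vw` an
edge oriented by its colours are used, and the others are isolated. -/
abbrev SubdVertex (V : Type*) (N : ℕ) : Type _ := V ⊕ (V × V × Fin (N + 2))

/-- The colours used on the subdivided graph; their number does not depend on `N`. -/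
abbrev SubdColour (K B : Type*) : Type _ := K ⊕ (K × K × B × Fin 3 × Bool × Bool)

/-- The colouring of the subdivided graph. The subdivision vertices of an edge `vw` show the
colours `g v` and `g w`, a letter of the word `τ`, their position modulo 3, and one bit each of the
unary codes of `ψ v` and `ψ w`. The position modulo 3 determines the direction of travel, and `τ`,
chosen without squares, excludes repetitions inside an edge. -/
def subdColouring (g : V → K) (ψ : V → Fin N) (τ : ℕ → B) : SubdVertex V N → SubdColour K B
  | .inl v => .inl (g v)
  | .inr (v, w, d) => .inr (g v, g w, τ d, Fin.ofNat 3 d, decide ((ψ v : ℕ) + 1 = d),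
      decide ((ψ w : ℕ) + 1 = d))

theorem isLeft_subdColouring (g : V → K) (ψ : V → Fin N) (τ : ℕ → B) (x : SubdVertex V N) :
    (subdColouring g ψ τ x).isLeft = x.isLeft := by
  cases x <;> rfl

theorem subdColouring_inl_inj {g : V → K} {ψ : V → Fin N} {τ : ℕ → B} {v w : V} :
    subdColouring g ψ τ (.inl v) = subdColouring g ψ τ (.inl w) ↔ g v = g w :=
  Sum.inl_injective.eq_iff

theorem isLeft_eq_of_subdColouring_eq {g : V → K} {ψ : V → Fin N} {τ : ℕ → B}
    {x y : SubdVertex V N}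
    (h : subdColouring g ψ τ x = subdColouring g ψ τ y) : x.isLeft = y.isLeft := by
  rw [← isLeft_subdColouring g ψ τ x, h, isLeft_subdColouring]

variable [LinearOrder K]

/-- The vertex at distance `d ≤ N + 1` from `v` on the subdivided edge `vw`. -/
def subdPoint (g : V → K) (N : ℕ) (v w : V) (d : ℕ) : SubdVertex V N :=
  if d = 0 then .inl v
  else if N < d then .inl w
  else if g v < g w then .inr (v, w, Fin.ofNat (N + 2) d)
  else .inr (w, v, Fin.ofNat (N + 2) (N + 1 - d))

/-- The graph obtained from `G` by subdividing each edge `N` times. -/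
def subdivision (G : SimpleGraph V) (g : V → K) (N : ℕ) : SimpleGraph (SubdVertex V N) :=
  SimpleGraph.fromRel fun x y =>
    ∃ v w d, G.Adj v w ∧ d ≤ N ∧ x = subdPoint g N v w d ∧ y = subdPoint g N v w (d + 1)

section Points

variable {g : V → K} {v w v' w' x : V} {d d' : ℕ}

theorem subdPoint_zero : subdPoint g N v w 0 = .inl v := by simp [subdPoint]

theorem subdPoint_last : subdPoint g N v w (N + 1) = .inl w := by simp [subdPoint]

theorem subdPoint_of_lt (hd : 1 ≤ d) (hdN : d ≤ N) (h : g v < g w) :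
    subdPoint g N v w d = .inr (v, w, Fin.ofNat (N + 2) d) := by
  simp [subdPoint, h, show d ≠ 0 by lia, show ¬ N < d by lia]

theorem isLeft_subdPoint : (subdPoint g N v w d).isLeft ↔ d = 0 ∨ N < d := by
  unfold subdPoint
  split_ifs <;> simp_all

theorem subdPoint_symm (hvw : g v ≠ g w) (hd : d ≤ N + 1) :
    subdPoint g N w v (N + 1 - d) = subdPoint g N v w d := by
  obtain rfl | hpos := Nat.eq_zero_or_pos d
  · simp [subdPoint]
  obtain rfl | hdN := hd.eq_or_lt
  · simp [subdPoint]
  obtain h | h := hvw.lt_or_gt <;>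
    simp [subdPoint, h, h.not_gt, hpos.ne', show ¬ N < d by lia,
      show ¬ N < N + 1 - d by lia, show N + 1 - (N + 1 - d) = d by lia,
      show ¬ N + 1 - d = 0 by lia]

theorem eq_of_subdPoint_eq_inl (hd : d ≤ N + 1) (h : subdPoint g N v w d = .inl x) :
    (d = 0 ∧ v = x) ∨ (d = N + 1 ∧ w = x) := by
  obtain rfl | hdN : d = 0 ∨ N < d := isLeft_subdPoint.1 (by rw [h]; rfl)
  · exact .inl ⟨rfl, Sum.inl_injective (subdPoint_zero.symm.trans h)⟩
  · obtain rfl : d = N + 1 := by lia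
    exact .inr ⟨rfl, Sum.inl_injective (subdPoint_last.symm.trans h)⟩

theorem eq_of_subdPoint_eq_subdPoint (hvw : g v ≠ g w) (hvw' : g v' ≠ g w') (hd : 1 ≤ d)
    (hdN : d ≤ N) (hd' : d' ≤ N + 1) (h : subdPoint g N v w d = subdPoint g N v' w' d') :
    (v' = v ∧ w' = w ∧ d' = d) ∨ (v' = w ∧ w' = v ∧ d' = N + 1 - d) := by
  have hinner : ¬ (d' = 0 ∨ N < d') := by
    rw [← isLeft_subdPoint (g := g) (v := v') (w := w'), ← h, isLeft_subdPoint]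
    lia
  wlog hlt : g v < g w generalizing v w d
  · rw [← subdPoint_symm hvw (by lia)] at h
    have := this hvw.symm (by lia) (by lia) h (hvw.lt_or_gt.resolve_left hlt)
    rwa [show N + 1 - (N + 1 - d) = d by lia, or_comm] at this
  wlog hlt' : g v' < g w' generalizing v' w' d'
  · rw [← subdPoint_symm hvw' (by lia)] at h
    have := this hvw'.symm (by lia) (by lia) h (hvw'.lt_or_gt.resolve_left hlt')
    lia
  rw [subdPoint_of_lt hd hdN hlt, subdPoint_of_lt (by lia) (by lia) hlt'] at h
  simp only [Sum.inr.injEq, Prod.mk.injEq, Fin.ext_iff, Fin.val_ofNat] at h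
  rw [Nat.mod_eq_of_lt (by lia), Nat.mod_eq_of_lt (by lia)] at h
  exact .inl ⟨h.1.symm, h.2.1.symm, h.2.2.symm⟩

theorem eq_of_subdPoint_eq (hvw : g v ≠ g w) (hd : 1 ≤ d) (hdN : d ≤ N) (hd' : d' ≤ N + 1)
    (h : subdPoint g N v w d = subdPoint g N v w d') : d' = d :=
  (eq_of_subdPoint_eq_subdPoint hvw hvw hd hdN hd' h).elim (·.2.2) fun h' =>
    absurd (congrArg g h'.1) hvw

end Points

section Colours

variable {g : V → K} {ψ : V → Fin N} {τ : ℕ → B} {v w v' w' : V} {d d' : ℕ}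

theorem subdColouring_subdPoint_of_lt (hd : 1 ≤ d) (hdN : d ≤ N) (h : g v < g w) :
    subdColouring g ψ τ (subdPoint g N v w d) = .inr (g v, g w, τ d, Fin.ofNat 3 d,
      decide ((ψ v : ℕ) + 1 = d), decide ((ψ w : ℕ) + 1 = d)) := by
  rw [subdPoint_of_lt hd hdN h]
  simp only [subdColouring, Fin.val_ofNat, Nat.mod_eq_of_lt (show d < N + 2 by lia)]

theorem subdColouring_subdPoint_congr (hv : g v = g v') (hw : g w = g w') (hψv : ψ v = ψ v')
    (hψw : ψ w = ψ w') :
    subdColouring g ψ τ (subdPoint g N v w d) = subdColouring g ψ τ (subdPoint g N v' w' d) := by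
  simp only [subdPoint, hv, hw]
  split_ifs <;> simp [subdColouring, hv, hw, hψv, hψw]

theorem mod_three_eq_of_subdColouring_eq (hvw : g v ≠ g w) (hv : g v = g v') (hw : g w = g w')
    (hd : d ≤ N + 1) (hd' : d' ≤ N + 1)
    (h : subdColouring g ψ τ (subdPoint g N v w d) =
      subdColouring g ψ τ (subdPoint g N v' w' d')) : d % 3 = d' % 3 := by
  have hleft : d = 0 ∨ N < d ↔ d' = 0 ∨ N < d' := by
    rw [← isLeft_subdPoint (g := g) (v := v) (w := w), isLeft_eq_of_subdColouring_eq h,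
      isLeft_subdPoint]
  wlog hlt : g v < g w generalizing v w v' w' d d'
  · have hlt' := hvw.lt_or_gt.resolve_left hlt
    rw [← subdPoint_symm hvw hd, ← subdPoint_symm (hv ▸ hw ▸ hvw) hd'] at h
    have := this hvw.symm hw hv (by lia) (by lia) h (by lia) hlt'
    lia
  by_cases hend : d = 0 ∨ N < d
  · obtain rfl | hdN := hend <;> obtain rfl | hdN' := hleft.1 (by lia)
    · rfl
    · rw [show d' = N + 1 by lia, subdPoint_zero, subdPoint_last, subdColouring_inl_inj,
        ← hw] at h
      exact absurd h hvw
    · rw [show d = N + 1 by lia, subdPoint_zero, subdPoint_last, subdColouring_inl_inj,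
        ← hv] at h
      exact absurd h.symm hvw
    · lia
  · rw [subdColouring_subdPoint_of_lt (by lia) (by lia) hlt,
      subdColouring_subdPoint_of_lt (by lia) (by lia) (hv ▸ hw ▸ hlt)] at h
    simp only [Sum.inr.injEq, Prod.mk.injEq] at h
    simpa using congrArg Fin.val h.2.2.2.1

theorem sym2_eq_of_subdColouring_eq (hvw : g v ≠ g w) (hvw' : g v' ≠ g w') (hd : 1 ≤ d)
    (hdN : d ≤ N) (hd' : 1 ≤ d') (hdN' : d' ≤ N)
    (h : subdColouring g ψ τ (subdPoint g N v w d) =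
      subdColouring g ψ τ (subdPoint g N v' w' d')) : s(g v, g w) = s(g v', g w') := by
  wlog hlt : g v < g w generalizing v w d
  · rw [← subdPoint_symm hvw (by lia)] at h
    rw [Sym2.eq_swap]
    exact this hvw.symm (by lia) (by lia) h (hvw.lt_or_gt.resolve_left hlt)
  wlog hlt' : g v' < g w' generalizing v' w' d'
  · rw [← subdPoint_symm hvw' (by lia)] at h
    rw [@Sym2.eq_swap _ (g v')]
    exact this hvw'.symm (by lia) (by lia) h (hvw'.lt_or_gt.resolve_left hlt')
  rw [subdColouring_subdPoint_of_lt hd hdN hlt, subdColouring_subdPoint_of_lt hd' hdN' hlt'] at h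
  simp only [Sum.inr.injEq, Prod.mk.injEq] at h
  rw [h.1, h.2.1]

theorem eq_of_forall_subdColouring_eq (hvw : g v ≠ g w) (hv : g v = g v') (hw : g w = g w')
    (h : ∀ l, 1 ≤ l → l ≤ N → subdColouring g ψ τ (subdPoint g N v w l) =
      subdColouring g ψ τ (subdPoint g N v' w' l)) : ψ v = ψ v' ∧ ψ w = ψ w' := by
  wlog hlt : g v < g w generalizing v w v' w'
  · refine (this hvw.symm hw hv (fun l hl hlN => ?_) (hvw.lt_or_gt.resolve_left hlt)).symm
    have := h (N + 1 - l) (by lia) (by lia)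
    rwa [subdPoint_symm hvw.symm (by lia), subdPoint_symm (hv ▸ hw ▸ hvw.symm) (by lia)] at this
  have hbits : ∀ l, 1 ≤ l → l ≤ N → ((ψ v : ℕ) + 1 = l ↔ (ψ v' : ℕ) + 1 = l) ∧
      ((ψ w : ℕ) + 1 = l ↔ (ψ w' : ℕ) + 1 = l) := by
    intro l hl hlN
    have := h l hl hlN
    rw [subdColouring_subdPoint_of_lt hl hlN hlt,
      subdColouring_subdPoint_of_lt hl hlN (hv ▸ hw ▸ hlt)] at this
    simp only [Sum.inr.injEq, Prod.mk.injEq, decide_eq_decide] at this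
    exact this.2.2.2.2
  have hbit_v := (hbits (ψ v + 1) (by lia) (ψ v).2).1.1 rfl
  have hbit_w := (hbits (ψ w + 1) (by lia) (ψ w).2).2.1 rfl
  exact ⟨Fin.ext (by lia), Fin.ext (by lia)⟩

end Colours

section Adjacency

variable {G : SimpleGraph V} {g : V → K} {v w : V} {d : ℕ} {x y z : SubdVertex V N}

theorem subdivision_adj (hg : ∀ v w, G.Adj v w → g v ≠ g w) : (subdivision G g N).Adj x y ↔
    ∃ v w d, G.Adj v w ∧ d ≤ N ∧ x = subdPoint g N v w d ∧ y = subdPoint g N v w (d + 1) := by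
  simp only [subdivision, SimpleGraph.fromRel_adj]
  constructor
  · rintro ⟨-, h | ⟨v, w, d, h, hd, rfl, rfl⟩⟩
    · exact h
    · refine ⟨w, v, N - d, h.symm, by lia, ?_, ?_⟩
      · rw [← subdPoint_symm (hg v w h) (by lia), show N + 1 - (d + 1) = N - d by lia]
      · rw [← subdPoint_symm (hg v w h) (by lia), show N + 1 - d = N - d + 1 by lia]
  · rintro ⟨v, w, d, h, hd, rfl, rfl⟩
    refine ⟨fun heq => ?_, .inl ⟨v, w, d, h, hd, rfl, rfl⟩⟩
    obtain rfl | hpos := Nat.eq_zero_or_pos d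
    · rw [subdPoint_zero] at heq
      obtain ⟨h0, -⟩ | ⟨-, rfl⟩ := eq_of_subdPoint_eq_inl (by lia) heq.symm
      · lia
      · exact G.loopless.irrefl _ h
    · have := eq_of_subdPoint_eq (hg v w h) hpos hd (by lia) heq
      lia

theorem subdPoint_adj_succ (hg : ∀ v w, G.Adj v w → g v ≠ g w) (h : G.Adj v w) (hd : d ≤ N) :
    (subdivision G g N).Adj (subdPoint g N v w d) (subdPoint g N v w (d + 1)) :=
  (subdivision_adj hg).2 ⟨v, w, d, h, hd, rfl, rfl⟩

theorem exists_eq_of_inl_adj (hg : ∀ v w, G.Adj v w → g v ≠ g w)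
    (h : (subdivision G g N).Adj (.inl v) y) : ∃ w, G.Adj v w ∧ y = subdPoint g N v w 1 := by
  obtain ⟨a, b, e, hab, he, hx, rfl⟩ := (subdivision_adj hg).1 h
  obtain ⟨rfl, rfl⟩ | ⟨rfl, -⟩ := eq_of_subdPoint_eq_inl (by lia) hx.symm
  · exact ⟨b, hab, rfl⟩
  · lia

theorem eq_pred_or_eq_succ_of_subdPoint_adj (hg : ∀ v w, G.Adj v w → g v ≠ g w) (hvw : G.Adj v w)
    (hd : 1 ≤ d) (hdN : d ≤ N) (h : (subdivision G g N).Adj (subdPoint g N v w d) y) :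
    y = subdPoint g N v w (d - 1) ∨ y = subdPoint g N v w (d + 1) := by
  obtain ⟨a, b, e, hab, he, hx, rfl⟩ := (subdivision_adj hg).1 h
  obtain ⟨rfl, rfl, rfl⟩ | ⟨rfl, rfl, rfl⟩ :=
    eq_of_subdPoint_eq_subdPoint (hg v w hvw) (hg a b hab) hd hdN (by lia) hx
  · exact .inr rfl
  · left
    rw [← subdPoint_symm (hg _ _ hvw) (by lia)]
    congr 1
    lia

variable {ψ : V → Fin N} {τ : ℕ → B}

theorem subdColouring_ne_of_adj (hg : ∀ v w, G.Adj v w → g v ≠ g w)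
    (h : (subdivision G g N).Adj x y) : subdColouring g ψ τ x ≠ subdColouring g ψ τ y := by
  obtain ⟨v, w, d, hvw, hd, rfl, rfl⟩ := (subdivision_adj hg).1 h
  intro heq
  have := mod_three_eq_of_subdColouring_eq (hg v w hvw) rfl rfl (by lia) (by lia) heq
  lia

theorem injOn_subdColouring_neighborSet (hN : 0 < N) (hg : IsDistanceTwoColouring G g)
    (x : SubdVertex V N) :
    Set.InjOn (subdColouring g ψ τ) ((subdivision G g N).neighborSet x) := by
  obtain ⟨hg, hinj⟩ := isDistanceTwoColouring_iff.1 hg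
  intro y hy z hz heq
  obtain ⟨v, w, d, hvw, hd, rfl, -⟩ := (subdivision_adj hg).1 hy
  obtain rfl | hpos := Nat.eq_zero_or_pos d
  · rw [subdPoint_zero] at hy hz
    obtain ⟨a, ha, rfl⟩ := exists_eq_of_inl_adj hg hy
    obtain ⟨b, hb, rfl⟩ := exists_eq_of_inl_adj hg hz
    have hends := sym2_eq_of_subdColouring_eq (hg _ _ ha) (hg _ _ hb) le_rfl hN le_rfl hN heq
    rw [hinj v ha hb (Sym2.congr_right.1 hends)]
  · have hmod := fun {e e'} => mod_three_eq_of_subdColouring_eq (ψ := ψ) (τ := τ) (d := e)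
      (d' := e') (hg v w hvw) rfl rfl
    obtain rfl | rfl := eq_pred_or_eq_succ_of_subdPoint_adj hg hvw hpos hd hy <;>
      obtain rfl | rfl := eq_pred_or_eq_succ_of_subdPoint_adj hg hvw hpos hd hz
    · rfl
    · have := hmod (by lia) (by lia) heq
      lia
    · have := hmod (by lia) (by lia) heq
      lia
    · rfl

theorem isDistanceTwoColouring_subdColouring (hN : 0 < N) (hg : IsDistanceTwoColouring G g) :
    IsDistanceTwoColouring (subdivision G g N) (subdColouring g ψ τ) :=
  isDistanceTwoColouring_iff.2
    ⟨fun _ _ => subdColouring_ne_of_adj (isDistanceTwoColouring_iff.1 hg).1,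
      injOn_subdColouring_neighborSet hN hg⟩

end Adjacency

end Subdivision

theorem exists_le_eq_of_le_add_one {d : ℕ → ℕ} {n y : ℕ} (hd : ∀ i < n, d (i + 1) ≤ d i + 1)
    (h0 : d 0 ≤ y) (hn : y ≤ d n) : ∃ i ≤ n, d i = y := by
  induction n with
  | zero => exact ⟨0, le_rfl, by lia⟩
  | succ n ih =>
    obtain h | h := le_or_gt y (d n)
    · obtain ⟨i, hi, h⟩ := ih (fun i hi => hd i (by lia)) h
      exact ⟨i, by lia, h⟩
    · exact ⟨n + 1, le_rfl, by have := hd n (by lia); lia⟩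

section Positions

variable {B : Type*} {τ : ℕ → B} {d : ℕ → ℕ} {n t : ℕ}

/- By the discrete intermediate value theorem, the first half passes through `d 0, …, d 0 + k - 1`,
so the second half passes through the next `k` positions. -/
theorem IsSquarefreeWord.exists_ne_of_forall_eq_add (hτ : IsSquarefreeWord n τ)
    (hdn : ∀ i < 2 * t, d i < n) (hstep : ∀ i, i + 1 < 2 * t → d (i + 1) ≤ d i + 1) (ht : 0 < t)
    {k : ℕ} (hk : 0 < k) (hd : ∀ i < t, d (t + i) = d i + k) :
    ∃ i < t, τ (d i) ≠ τ (d (t + i)) := by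
  by_contra! heq
  have hvisit : ∀ j < k, ∃ i < t, d i = d 0 + j := by
    intro j hj
    have hlast := hstep (t - 1) (by lia)
    rw [Nat.sub_add_cancel ht, ← Nat.add_zero t, hd 0 ht, Nat.add_zero] at hlast
    obtain ⟨i, hi, h⟩ := exists_le_eq_of_le_add_one (n := t - 1) (y := d 0 + j)
      (fun i hi => hstep i (by lia)) (by lia) (by lia)
    exact ⟨i, by lia, h⟩
  obtain ⟨i, hi, htop⟩ := hvisit (k - 1) (by lia)
  have hlt := hdn (t + i) (by lia)
  rw [hd i hi] at hlt
  refine hτ (d 0) k hk (by lia) fun j hj => ?_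
  obtain ⟨i, hi, hij⟩ := hvisit j hj
  rw [← hij, heq i hi, hd i hi, hij]
  congr 1
  lia

theorem add_eq_add_of_mod_three_eq
    (hstep : ∀ i, i + 1 < 2 * t → d (i + 1) = d i + 1 ∨ d i = d (i + 1) + 1)
    (hmod : ∀ i < t, d i % 3 = d (t + i) % 3) : ∀ i < t, d (t + i) + d 0 = d i + d t := by
  intro i hi
  induction i with
  | zero => exact add_comm _ _
  | succ i ih =>
    have := ih (by lia)
    have := hmod i (by lia)
    have hmod_succ := hmod (i + 1) hi
    have hstep_left := hstep i (by lia)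
    have hstep_right := hstep (t + i) (by lia)
    rw [← add_assoc] at hmod_succ ⊢
    lia

-- If `d t < d 0`, then the walk is traversed backwards.
theorem IsSquarefreeWord.exists_ne_of_mod_three_eq (hτ : IsSquarefreeWord n τ)
    (hdn : ∀ i < 2 * t, d i < n)
    (hstep : ∀ i, i + 1 < 2 * t → d (i + 1) = d i + 1 ∨ d i = d (i + 1) + 1)
    (hmod : ∀ i < t, d i % 3 = d (t + i) % 3) (ht : 0 < t) (hne : d 0 ≠ d t) :
    ∃ i < t, τ (d i) ≠ τ (d (t + i)) := by
  have hd := add_eq_add_of_mod_three_eq hstep hmod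
  obtain h | h := hne.lt_or_gt
  · exact hτ.exists_ne_of_forall_eq_add hdn (fun i hi => by have := hstep i hi; lia) ht
      (Nat.sub_pos_of_lt h) fun i hi => by have := hd i hi; lia
  · obtain ⟨i, hi, h⟩ := hτ.exists_ne_of_forall_eq_add (d := fun i => d (2 * t - 1 - i))
      (fun _ _ => hdn _ (by lia))
      (fun i hi => by
        have := hstep (2 * t - 1 - (i + 1)) (by lia)
        rw [show 2 * t - 1 - (i + 1) + 1 = 2 * t - 1 - i by lia] at this
        lia)
      ht (Nat.sub_pos_of_lt h) fun i hi => by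
        have := hd (t - 1 - i) (by lia)
        rw [show t + (t - 1 - i) = 2 * t - 1 - i by lia] at this
        rw [show 2 * t - 1 - (t + i) = t - 1 - i by lia]
        lia
    refine ⟨t - 1 - i, by lia, ?_⟩
    rw [show t + (t - 1 - i) = 2 * t - 1 - i by lia,
      show t - 1 - i = 2 * t - 1 - (t + i) by lia]
    exact h.symm

end Positions

section InnerRepetition

variable {V K B : Type*} [LinearOrder K] {N n t : ℕ} {G : SimpleGraph V} {g : V → K}
  {u : ℕ → SubdVertex V N}

theorem subdPoint_adj_subdPoint {v w : V} {d e : ℕ} (hg : ∀ v w, G.Adj v w → g v ≠ g w)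
    (hvw : G.Adj v w) (hd : 1 ≤ d) (hdN : d ≤ N) (he : 1 ≤ e) (heN : e ≤ N)
    (h : (subdivision G g N).Adj (subdPoint g N v w d) (subdPoint g N v w e)) :
    e = d + 1 ∨ d = e + 1 := by
  obtain h | h := eq_pred_or_eq_succ_of_subdPoint_adj hg hvw hd hdN h <;>
    have := eq_of_subdPoint_eq (hg v w hvw) he heN (by lia) h <;> lia

theorem exists_subdPoint_of_forall_not_isLeft (hg : ∀ v w, G.Adj v w → g v ≠ g w) (hn : 1 < n)
    (hu : IsWalkSeq (subdivision G g N) n u) (hleft : ∀ i < n, ¬ (u i).isLeft) :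
    ∃ v w, G.Adj v w ∧ g v < g w ∧
      ∀ i < n, ∃ d, 1 ≤ d ∧ d ≤ N ∧ u i = subdPoint g N v w d := by
  have hinner : ∀ {i v w d}, i < n → d ≤ N + 1 → u i = subdPoint g N v w d → 1 ≤ d ∧ d ≤ N := by
    intro i v w d hi hd h
    have := hleft i hi
    rw [h, isLeft_subdPoint] at this
    lia
  obtain ⟨v, w, d, hvw, hlt, hd, hu0⟩ :
      ∃ v w d, G.Adj v w ∧ g v < g w ∧ d ≤ N + 1 ∧ u 0 = subdPoint g N v w d := by
    obtain ⟨v, w, d, hvw, hd, hu0, -⟩ := (subdivision_adj hg).1 (hu 0 hn)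
    obtain h | h := (hg v w hvw).lt_or_gt
    · exact ⟨v, w, d, hvw, h, by lia, hu0⟩
    · exact ⟨w, v, N + 1 - d, hvw.symm, h, by lia,
        hu0.trans (subdPoint_symm (hg v w hvw) (by lia)).symm⟩
  refine ⟨v, w, hvw, hlt, fun i hi => ?_⟩
  induction i with
  | zero => exact ⟨d, (hinner hi hd hu0).1, (hinner hi hd hu0).2, hu0⟩
  | succ i ih =>
    obtain ⟨e, he, heN, hui⟩ := ih (by lia)
    obtain h | h := eq_pred_or_eq_succ_of_subdPoint_adj hg hvw he heN (hui ▸ hu i hi)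
    · exact ⟨e - 1, (hinner hi (by lia) h).1, by lia, h⟩
    · exact ⟨e + 1, by lia, (hinner hi (by lia) h).2, h⟩

theorem exists_isLeft_of_isRepetitiveSeq {ψ : V → Fin N} {τ : ℕ → B}
    (hg : ∀ v w, G.Adj v w → g v ≠ g w) (hτ : IsSquarefreeWord (N + 1) τ) (ht : 0 < t)
    (hu : IsWalkSeq (subdivision G g N) (2 * t) u) (hne : u 0 ≠ u t)
    (hrep : IsRepetitiveSeq (subdColouring g ψ τ) t u) : ∃ i < t, (u i).isLeft := by
  by_contra! hleft
  have hleft' : ∀ i < 2 * t, ¬ (u i).isLeft := by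
    intro i hi
    obtain hit | ⟨j, rfl⟩ := (lt_or_ge i t).imp_right Nat.exists_eq_add_of_le
    · exact hleft i hit
    · rw [← isLeft_eq_of_subdColouring_eq (hrep j (by lia))]
      exact hleft j (by lia)
  obtain ⟨v, w, hvw, hlt, hpos⟩ := exists_subdPoint_of_forall_not_isLeft hg (by lia) hu hleft'
  choose! d hd hdN hud using hpos
  obtain ⟨i, hi, h⟩ := hτ.exists_ne_of_mod_three_eq (d := d)
    (fun i hi => Nat.lt_succ_of_le (hdN i hi))
    (fun i hi => subdPoint_adj_subdPoint hg hvw (hd i (by lia)) (hdN i (by lia)) (hd _ hi)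
      (hdN _ hi) (hud i (by lia) ▸ hud (i + 1) hi ▸ hu i hi))
    (fun i hi => mod_three_eq_of_subdColouring_eq (hg v w hvw) rfl rfl
      (by have := hdN i (by lia); lia) (by have := hdN (t + i) (by lia); lia)
      (hud i (by lia) ▸ hud (t + i) (by lia) ▸ hrep i hi))
    ht (fun h => hne (by rw [hud 0 (by lia), hud t (by lia), h]))
  have := hrep i hi
  rw [hud i (by lia), hud (t + i) (by lia),
    subdColouring_subdPoint_of_lt (hd _ (by lia)) (hdN _ (by lia)) hlt,
    subdColouring_subdPoint_of_lt (hd _ (by lia)) (hdN _ (by lia)) hlt] at this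
  simp only [Sum.inr.injEq, Prod.mk.injEq] at this
  exact h this.2.2.1

end InnerRepetition

theorem forall_lt_of_forall_iff_succ {P : ℕ → Prop} {n i₀ : ℕ}
    (h : ∀ i, i + 1 < n → (P i ↔ P (i + 1))) (hi₀ : i₀ < n) (h₀ : P i₀) : ∀ i < n, P i := by
  have hzero : ∀ i < n, (P 0 ↔ P i) := by
    intro i hi
    induction i with
    | zero => rfl
    | succ i ih => exact (ih (by lia)).trans (h i hi)
  exact fun i hi => (hzero i hi).1 ((hzero i₀ hi₀).2 h₀)

section ClosedStar

variable {V K : Type*} [LinearOrder K] {N D : ℕ} {G : SimpleGraph V} {g : V → K}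
  {x y : SubdVertex V N} {v : V}

open Classical in
/-- The vertices of the subdivided graph on the subdivided edges at the original vertex `v`,
including their ends. -/
noncomputable def closedStar (G : SimpleGraph V) (g : V → K) (N : ℕ) (v : V)
    [Fintype (G.neighborSet v)] : Finset (SubdVertex V N) :=
  insert (.inl v) ((G.neighborFinset v ×ˢ Finset.Icc 1 (N + 1)).image
    fun q => subdPoint g N v q.1 q.2)

section

variable [Fintype (G.neighborSet v)]

theorem mem_closedStar : x ∈ closedStar G g N v ↔
    x = .inl v ∨ ∃ w, G.Adj v w ∧ ∃ d, 1 ≤ d ∧ d ≤ N + 1 ∧ x = subdPoint g N v w d := by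
  simp only [closedStar, Finset.mem_insert, Finset.mem_image, Finset.mem_product,
    SimpleGraph.mem_neighborFinset, Finset.mem_Icc, Prod.exists]
  grind

theorem subdPoint_mem_closedStar {w : V} {d : ℕ} (hvw : G.Adj v w) (hd : d ≤ N + 1) :
    subdPoint g N v w d ∈ closedStar G g N v := by
  obtain rfl | hpos := Nat.eq_zero_or_pos d
  · exact mem_closedStar.2 (.inl subdPoint_zero)
  · exact mem_closedStar.2 (.inr ⟨w, hvw, d, hpos, hd, rfl⟩)

theorem mem_closedStar_of_adj (hg : ∀ v w, G.Adj v w → g v ≠ g w) (hx : x ∈ closedStar G g N v)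
    (hleft : ∀ z, x = .inl z → z = v) (hxy : (subdivision G g N).Adj x y) :
    y ∈ closedStar G g N v := by
  by_cases hxl : x.isLeft
  · obtain ⟨z, rfl⟩ := Sum.isLeft_iff.1 hxl
    obtain rfl := hleft z rfl
    obtain ⟨w, hvw, rfl⟩ := exists_eq_of_inl_adj hg hxy
    exact subdPoint_mem_closedStar hvw (by lia)
  · obtain rfl | ⟨w, hvw, d, hd, -, rfl⟩ := mem_closedStar.1 hx
    · simp at hxl
    · rw [isLeft_subdPoint] at hxl
      obtain rfl | rfl := eq_pred_or_eq_succ_of_subdPoint_adj hg hvw hd (by lia) hxy <;>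
        exact subdPoint_mem_closedStar hvw (by lia)

theorem card_closedStar_le (hD : G.degree v ≤ D) :
    #(closedStar G g N v) ≤ (D + 1) * (N + 1) := by
  classical
  calc #(closedStar G g N v) ≤ G.degree v * (N + 1) + 1 := by
        refine (Finset.card_insert_le _ _).trans <|
          Nat.succ_le_succ <| Finset.card_image_le.trans_eq ?_
        rw [Finset.card_product, Nat.card_Icc, Nat.add_sub_cancel, G.card_neighborFinset_eq_degree]
    _ ≤ D * (N + 1) + (N + 1) := by gcongr; lia
    _ = (D + 1) * (N + 1) := by ring

end

theorem card_vertices_subdivision_le [G.LocallyFinite] [DecidableEq (SubdVertex V N)]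
    (hg : ∀ v w, G.Adj v w → g v ≠ g w) (hD : ∀ v, G.degree v ≤ D) {n i₀ : ℕ}
    {u : ℕ → SubdVertex V N} (hu : IsWalkSeq (subdivision G g N) n u) {S : Finset V}
    (hS : ∀ i < n, ∀ z, u i = .inl z → z ∈ S) (hi₀ : i₀ < n) (hleft : (u i₀).isLeft) :
    #(vertices n u) ≤ #S * ((D + 1) * (N + 1)) := by
  have hstep : ∀ {i x}, i < n → (subdivision G g N).Adj (u i) x →
      (∃ v ∈ S, u i ∈ closedStar G g N v) → ∃ v ∈ S, x ∈ closedStar G g N v := by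
    rintro i x hi hx ⟨v, hv, hui⟩
    by_cases hl : (u i).isLeft
    · obtain ⟨z, hz⟩ := Sum.isLeft_iff.1 hl
      exact ⟨z, hS i hi z hz, mem_closedStar_of_adj hg (mem_closedStar.2 (.inl hz))
        (fun z' h => Sum.inl_injective (h.symm.trans hz)) hx⟩
    · exact ⟨v, hv, mem_closedStar_of_adj hg hui (fun z h => absurd (by rw [h]; rfl) hl) hx⟩
  obtain ⟨z, hz⟩ := Sum.isLeft_iff.1 hleft
  have hstar : ∀ i < n, ∃ v ∈ S, u i ∈ closedStar G g N v :=
    forall_lt_of_forall_iff_succ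
      (fun i hi => ⟨hstep (by lia) (hu i hi), hstep hi (hu i hi).symm⟩) hi₀
      ⟨z, hS i₀ hi₀ z hz, mem_closedStar.2 (.inl hz)⟩
  have hsub : vertices n u ⊆ S.biUnion fun v => closedStar G g N v := by
    intro x hx
    obtain ⟨i, hi, rfl⟩ := mem_vertices.1 hx
    simpa using hstar i hi
  exact (Finset.card_le_card hsub).trans
    (Finset.card_biUnion_le_card_mul _ _ _ fun v _ => card_closedStar_le (hD v))

end ClosedStar

section CoupledWalks

variable {V C : Type*} {G : SimpleGraph V} {f : V → C}

/-- The graph whose walks are the pairs of walks in `G` that are equally coloured by `f` and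
disagree everywhere. -/
def coupledGraph (G : SimpleGraph V) (f : V → C) : SimpleGraph (V × V) where
  Adj p q := (G.Adj p.1 q.1 ∧ G.Adj p.2 q.2) ∧ (f p.1 = f p.2 ∧ f q.1 = f q.2) ∧
    p.1 ≠ p.2 ∧ q.1 ≠ q.2
  symm := ⟨fun _ _ h => ⟨⟨h.1.1.symm, h.1.2.symm⟩, h.2.1.symm, h.2.2.symm⟩⟩
  loopless := ⟨fun _ h => G.loopless.irrefl _ h.1.1⟩

open Classical in
/-- The vertices of `G` on the two walks of a pair. -/
noncomputable def coupledVertices {p q : V × V} (c : (coupledGraph G f).Walk p q) : Finset V :=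
  c.support.toFinset.image Prod.fst ∪ c.support.toFinset.image Prod.snd

theorem mem_coupledVertices {p q : V × V} {c : (coupledGraph G f).Walk p q} {x : V} :
    x ∈ coupledVertices c ↔
      ∃ i ≤ c.length, (c.getVert i).1 = x ∨ (c.getVert i).2 = x := by
  simp only [coupledVertices, Finset.mem_union, Finset.mem_image, List.mem_toFinset,
    SimpleGraph.Walk.mem_support_iff_exists_getVert]
  grind

theorem coupledVertices_subset_concat {p q r : V × V} (c : (coupledGraph G f).Walk p q)
    (h : (coupledGraph G f).Adj q r) : coupledVertices c ⊆ coupledVertices (c.concat h) := by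
  have hsub := c.support_subset_support_concat h
  intro x hx
  simp only [coupledVertices, Finset.mem_union, Finset.mem_image, List.mem_toFinset] at hx ⊢
  exact hx.imp (fun ⟨r, hr, hrx⟩ => ⟨r, hsub hr, hrx⟩) fun ⟨r, hr, hrx⟩ => ⟨r, hsub hr, hrx⟩

/-- The sequence consisting of the first `m` terms of `a` followed by the sequence `b`. -/
def glue (m : ℕ) (a b : ℕ → V) : ℕ → V := fun i => if i < m then a i else b (i - m)

theorem glue_of_lt {m i : ℕ} {a b : ℕ → V} (hi : i < m) : glue m a b i = a i := if_pos hi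

theorem glue_add {m i : ℕ} {a b : ℕ → V} : glue m a b (m + i) = b i := by
  simp [glue]

theorem isWalkSeq_glue {m n : ℕ} {a b : ℕ → V} (ha : IsWalkSeq G m a) (hb : IsWalkSeq G n b)
    (hab : G.Adj (a (m - 1)) (b 0)) : IsWalkSeq G (m + n) (glue m a b) := by
  intro i hi
  obtain h | h | h := Nat.lt_trichotomy (i + 1) m
  · rw [glue_of_lt h, glue_of_lt (by lia)]
    exact ha i h
  · obtain rfl : i = m - 1 := by lia
    rw [glue_of_lt (by lia), h]
    simpa only [glue, lt_irrefl, if_false, Nat.sub_self] using hab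
  · obtain ⟨j, rfl⟩ := Nat.exists_eq_add_of_le (Nat.le_of_lt_succ h)
    rw [glue_add, add_assoc, glue_add]
    exact hb j (by lia)

theorem coupled_getVert {p q : V × V} {c : (coupledGraph G f).Walk p q} (hc : 0 < c.length)
    {i : ℕ} (hi : i ≤ c.length) :
    f (c.getVert i).1 = f (c.getVert i).2 ∧ (c.getVert i).1 ≠ (c.getVert i).2 := by
  obtain h | rfl := hi.lt_or_eq
  · have := c.adj_getVert_succ h
    exact ⟨this.2.1.1, this.2.2.1⟩
  · have := c.adj_getVert_succ (i := c.length - 1) (by lia)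
    rw [Nat.sub_add_cancel hc] at this
    exact ⟨this.2.1.2, this.2.2.2⟩

theorem exists_isRepetitiveSeq_of_coupled {p q : V × V} {c : (coupledGraph G f).Walk p q}
    (hc : 0 < c.length) {m : ℕ} (hm : m ≤ c.length + 1)
    (hadj : G.Adj (c.getVert (m - 1)).1 p.2) :
    ∃ w, IsWalkSeq G (2 * m) w ∧ IsRepetitiveSeq f m w ∧ (∀ i < m, w i ≠ w (m + i)) ∧
      ∀ i < m, w i = (c.getVert i).1 ∧ w (m + i) = (c.getVert i).2 := by
  refine ⟨glue m (fun i => (c.getVert i).1) (fun i => (c.getVert i).2), ?_, ?_, ?_, ?_⟩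
  · rw [two_mul]
    exact isWalkSeq_glue (fun i hi => (c.adj_getVert_succ (by lia)).1.1)
      (fun i hi => (c.adj_getVert_succ (by lia)).1.2) (by rwa [c.getVert_zero])
  · intro i hi
    rw [glue_of_lt hi, glue_add]
    exact (coupled_getVert hc (by lia)).1
  · intro i hi
    rw [glue_of_lt hi, glue_add]
    exact (coupled_getVert hc (by lia)).2
  · exact fun i hi => ⟨glue_of_lt hi, glue_add⟩

theorem exists_isRepetitiveSeq_card_coupledVertices_le [DecidableEq V] {p q : V × V}
    {c : (coupledGraph G f).Walk p q} (hc : 0 < c.length) (hjoin : q.1 = p.2 ∨ G.Adj q.1 p.2) :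
    ∃ m w, 0 < m ∧ m ≤ c.length + 1 ∧ IsWalkSeq G (2 * m) w ∧ IsRepetitiveSeq f m w ∧
      (∀ i < m, w i ≠ w (m + i)) ∧ #(coupledVertices c) ≤ #(vertices (2 * m) w) + 1 := by
  obtain hjoin | hjoin := hjoin
  · -- The last term of the first walk is the first term of the second walk and is not repeated.
    have hadj := (c.adj_getVert_succ (i := c.length - 1) (by lia)).1.1
    rw [Nat.sub_add_cancel hc, c.getVert_length, hjoin] at hadj
    obtain ⟨w, hw, hrep, hne, hval⟩ := exists_isRepetitiveSeq_of_coupled hc (by lia) hadj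
    refine ⟨c.length, w, hc, by lia, hw, hrep, hne,
      (Finset.card_le_card fun x hx => ?_).trans (Finset.card_insert_le q.2 _)⟩
    obtain ⟨i, hi, hix⟩ := mem_coupledVertices.1 hx
    obtain hi | rfl := hi.lt_or_eq
    · obtain rfl | rfl := hix
      · exact Finset.mem_insert_of_mem (mem_vertices.2 ⟨i, by lia, (hval i hi).1⟩)
      · exact Finset.mem_insert_of_mem (mem_vertices.2 ⟨_, by lia, (hval i hi).2⟩)
    · rw [c.getVert_length] at hix
      obtain rfl | rfl := hix
      · rw [hjoin]
        exact Finset.mem_insert_of_mem (mem_vertices.2 ⟨c.length + 0, by lia, by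
          rw [(hval 0 hc).2, c.getVert_zero]⟩)
      · exact Finset.mem_insert_self _ _
  · obtain ⟨w, hw, hrep, hne, hval⟩ := exists_isRepetitiveSeq_of_coupled hc le_rfl
      (by rwa [Nat.add_sub_cancel, c.getVert_length])
    refine ⟨c.length + 1, w, by lia, le_rfl, hw, hrep, hne,
      (Finset.card_le_card fun x hx => ?_).trans (Nat.le_succ _)⟩
    obtain ⟨i, hi, rfl | rfl⟩ := mem_coupledVertices.1 hx
    · exact mem_vertices.2 ⟨i, by lia, (hval i (by lia)).1⟩
    · exact mem_vertices.2 ⟨_, by lia, (hval i (by lia)).2⟩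

end CoupledWalks

section Projection

variable {V K B : Type*} [LinearOrder K] {N : ℕ} {G : SimpleGraph V} {g : V → K}
  {ψ : V → Fin N} {τ : ℕ → B}

/-- The state `(x, y)` of two equally coloured walks in the subdivided graph that visited the
original vertices `p` last: they are at distance `d` from `p`, on edges that agree in colour up to
that point. -/
inductive IsSynced (G : SimpleGraph V) (g : V → K) (ψ : V → Fin N) (τ : ℕ → B) (p : V × V) :
    ℕ → SubdVertex V N → SubdVertex V N → Prop
  | atVertex : IsSynced G g ψ τ p 0 (.inl p.1) (.inl p.2)
  | onEdge {d : ℕ} {w w' : V} (hd : 1 ≤ d) (hdN : d ≤ N) (hw : G.Adj p.1 w) (hw' : G.Adj p.2 w')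
      (hcol : ∀ l, 1 ≤ l → l ≤ d → subdColouring g ψ τ (subdPoint g N p.1 w l) =
        subdColouring g ψ τ (subdPoint g N p.2 w' l)) :
      IsSynced G g ψ τ p d (subdPoint g N p.1 w d) (subdPoint g N p.2 w' d)

variable {p : V × V} {d : ℕ} {x y x' y' : SubdVertex V N}

theorem IsSynced.eq_or_eq {z : V} (h : IsSynced G g ψ τ p d x y) (hz : x = .inl z ∨ y = .inl z) :
    z = p.1 ∨ z = p.2 := by
  cases h with
  | atVertex =>
    exact hz.imp (fun h => (Sum.inl_injective h).symm) fun h => (Sum.inl_injective h).symm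
  | @onEdge _ w w' hd hdN =>
    have hleft : ∀ v w : V, subdPoint g N v w d ≠ .inl z := fun v w h => by
      have := isLeft_subdPoint.1 (show (subdPoint g N v w d).isLeft by rw [h]; rfl)
      lia
    exact (hz.elim (hleft _ _) (hleft _ _)).elim

theorem exists_common_subdPoint_of_adj (hg : ∀ v w, G.Adj v w → g v ≠ g w) {v w v' w' : V}
    (hv : g v = g v') (hw : g w = g w') (hvw : G.Adj v w) (hvw' : G.Adj v' w') (hd : 1 ≤ d)
    (hdN : d ≤ N) (hx : (subdivision G g N).Adj (subdPoint g N v w d) x)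
    (hy : (subdivision G g N).Adj (subdPoint g N v' w' d) y)
    (hcol : subdColouring g ψ τ x = subdColouring g ψ τ y) :
    ∃ e ≤ d + 1, x = subdPoint g N v w e ∧ y = subdPoint g N v' w' e := by
  have hmod := fun {e e'} => mod_three_eq_of_subdColouring_eq (ψ := ψ) (τ := τ) (d := e)
    (d' := e') (hg v w hvw) hv hw
  obtain rfl | rfl := eq_pred_or_eq_succ_of_subdPoint_adj hg hvw hd hdN hx <;>
    obtain rfl | rfl := eq_pred_or_eq_succ_of_subdPoint_adj hg hvw' hd hdN hy
  · exact ⟨d - 1, by lia, rfl, rfl⟩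
  · have := hmod (by lia) (by lia) hcol
    lia
  · have := hmod (by lia) (by lia) hcol
    lia
  · exact ⟨d + 1, le_rfl, rfl, rfl⟩

theorem IsSynced.step (hN : 0 < N) (hg : ∀ v w, G.Adj v w → g v ≠ g w) (hp : g p.1 = g p.2)
    (hp_ne : p.1 ≠ p.2) (h : IsSynced G g ψ τ p d x y) (hx : (subdivision G g N).Adj x x')
    (hy : (subdivision G g N).Adj y y') (hcol : subdColouring g ψ τ x' = subdColouring g ψ τ y')
    (hne : x' ≠ y') :
    (∃ d' ≤ d + 1, IsSynced G g ψ τ p d' x' y') ∨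
      d = N ∧ ∃ q, (coupledGraph G fun v => (g v, ψ v)).Adj p q ∧
        x' = .inl q.1 ∧ y' = .inl q.2 := by
  cases h with
  | atVertex =>
    obtain ⟨w, hw, rfl⟩ := exists_eq_of_inl_adj hg hx
    obtain ⟨w', hw', rfl⟩ := exists_eq_of_inl_adj hg hy
    refine .inl ⟨1, le_rfl, .onEdge le_rfl hN hw hw' fun l hl hl1 => ?_⟩
    rwa [show l = 1 by lia]
  | @onEdge _ w w' hd hdN hw hw' hcol_le =>
    have hgw : g w = g w' := by
      have := sym2_eq_of_subdColouring_eq (hg _ _ hw) (hg _ _ hw') hd hdN hd hdN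
        (hcol_le d hd le_rfl)
      rwa [hp, Sym2.congr_right] at this
    obtain ⟨e, hed, rfl, rfl⟩ := exists_common_subdPoint_of_adj hg hp hgw hw hw' hd hdN hx hy hcol
    obtain rfl | he := Nat.eq_zero_or_pos e
    · rw [subdPoint_zero, subdPoint_zero]
      exact .inl ⟨0, hed, .atVertex⟩
    obtain heN | heN := le_or_gt e N
    · refine .inl ⟨e, hed, .onEdge he heN hw hw' fun l hl hle => ?_⟩
      obtain rfl | hle := hle.eq_or_lt
      · exact hcol
      · exact hcol_le l hl (by lia)
    · obtain rfl : d = N := by lia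
      obtain rfl : e = d + 1 := by lia
      rw [subdPoint_last, subdPoint_last] at hne ⊢
      obtain ⟨hψp, hψw⟩ := eq_of_forall_subdColouring_eq (hg _ _ hw) hp hgw hcol_le
      exact .inr ⟨rfl, (w, w'), ⟨⟨hw, hw'⟩, ⟨Prod.ext hp hψp, Prod.ext hgw hψw⟩, hp_ne,
        fun h => hne (congrArg Sum.inl h)⟩, rfl, rfl⟩

theorem IsSynced.mem_closedStar_of_adj [Fintype (G.neighborSet p.1)]
    (hg : ∀ v w, G.Adj v w → g v ≠ g w) (h : IsSynced G g ψ τ p d x y)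
    (hx : (subdivision G g N).Adj x x') : x' ∈ closedStar G g N p.1 := by
  cases h with
  | atVertex =>
    exact WalkColouring.mem_closedStar_of_adj hg (mem_closedStar.2 (.inl rfl))
      (fun z h => (Sum.inl_injective h).symm) hx
  | onEdge hd hdN hw =>
    refine WalkColouring.mem_closedStar_of_adj hg (subdPoint_mem_closedStar hw (by lia))
      (fun z h => ?_) hx
    have := isLeft_subdPoint.1 (show (subdPoint g N _ _ d).isLeft by rw [h]; rfl)
    lia

theorem exists_coupled_walk {p₀ : V × V} {m : ℕ} {x y : ℕ → SubdVertex V N} (hN : 0 < N)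
    (hg : ∀ v w, G.Adj v w → g v ≠ g w) (hx : IsWalkSeq (subdivision G g N) m x)
    (hy : IsWalkSeq (subdivision G g N) m y)
    (hcol : ∀ i < m, subdColouring g ψ τ (x i) = subdColouring g ψ τ (y i))
    (hne : ∀ i < m, x i ≠ y i) (hx₀ : x 0 = .inl p₀.1) (hy₀ : y 0 = .inl p₀.2) {i : ℕ}
    (hi : i < m) :
    ∃ p, ∃ c : (coupledGraph G fun v => (g v, ψ v)).Walk p₀ p, ∃ d,
      (g p.1 = g p.2 ∧ p.1 ≠ p.2) ∧ IsSynced G g ψ τ p d (x i) (y i) ∧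
      c.length * (N + 1) + d ≤ i ∧
      ∀ j ≤ i, ∀ z, (x j = .inl z ∨ y j = .inl z) → z ∈ coupledVertices c := by
  induction i with
  | zero =>
    have hg₀ := hcol 0 hi
    have hne₀ := hne 0 hi
    rw [hx₀, hy₀] at hg₀ hne₀ ⊢
    refine ⟨p₀, .nil, 0, ⟨subdColouring_inl_inj.1 hg₀, fun h => hne₀ (congrArg _ h)⟩, .atVertex,
      by simp, fun j hj z hz => ?_⟩
    obtain rfl : j = 0 := by lia
    rw [hx₀, hy₀] at hz
    exact mem_coupledVertices.2 ⟨0, le_rfl, hz.imp (Sum.inl_injective ·) (Sum.inl_injective ·)⟩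
  | succ i ih =>
    obtain ⟨p, c, d, hp, hs, hlen, hvis⟩ := ih (by lia)
    have hcovered : ∀ {q d'} (c' : (coupledGraph G fun v => (g v, ψ v)).Walk p₀ q),
        coupledVertices c ⊆ coupledVertices c' →
        IsSynced G g ψ τ q d' (x (i + 1)) (y (i + 1)) →
        ∀ j ≤ i + 1, ∀ z, (x j = .inl z ∨ y j = .inl z) → z ∈ coupledVertices c' := by
      intro q d' c' hsub hs' j hj z hz
      obtain hj | rfl := Nat.le_succ_iff.1 hj
      · exact hsub (hvis j hj z hz)
      · refine mem_coupledVertices.2 ⟨c'.length, le_rfl, ?_⟩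
        rw [c'.getVert_length]
        exact (hs'.eq_or_eq hz).imp Eq.symm Eq.symm
    obtain ⟨d', hd', hs'⟩ | ⟨rfl, q, hpq, hxq, hyq⟩ :=
      hs.step hN hg hp.1 hp.2 (hx i hi) (hy i hi) (hcol _ hi) (hne _ hi)
    · exact ⟨p, c, d', hp, hs', by lia, hcovered c subset_rfl hs'⟩
    · have hs' : IsSynced G g ψ τ q 0 (x (i + 1)) (y (i + 1)) := hxq ▸ hyq ▸ .atVertex
      refine ⟨q, c.concat hpq, 0, ⟨congrArg Prod.fst hpq.2.1.2, hpq.2.2.2⟩, hs', ?_,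
        hcovered _ (coupledVertices_subset_concat c hpq) hs'⟩
      rw [SimpleGraph.Walk.length_concat, Nat.succ_mul]
      lia

variable {t D h : ℕ} {u : ℕ → SubdVertex V N}

theorem eq_or_adj_of_inl_mem_closedStar {v z : V} [Fintype (G.neighborSet v)]
    (hz : (.inl z : SubdVertex V N) ∈ closedStar G g N v) : v = z ∨ G.Adj v z := by
  obtain hzv | ⟨w, hvw, d, hd, hdN, hzd⟩ := mem_closedStar.1 hz
  · exact .inl (Sum.inl_injective hzv).symm
  · obtain ⟨rfl, -⟩ | ⟨-, rfl⟩ := eq_of_subdPoint_eq_inl hdN hzd.symm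
    · lia
    · exact .inr hvw

theorem mem_closedStar_of_isWalkSeq {v : V} [Fintype (G.neighborSet v)] {n : ℕ}
    (hg : ∀ v w, G.Adj v w → g v ≠ g w) (hu : IsWalkSeq (subdivision G g N) (n + 1) u)
    (h₀ : u 0 ∈ closedStar G g N v) (hleft : ∀ i < n, ¬ (u i).isLeft) :
    u n ∈ closedStar G g N v := by
  induction n with
  | zero => exact h₀
  | succ n ih =>
    refine mem_closedStar_of_adj hg (ih (fun i hi => hu i (by lia)) fun i hi => hleft i (by lia))
      (fun z hz => absurd (by rw [hz]; rfl) (hleft n (by lia))) (hu n (by lia))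

theorem exists_coupled_walk_of_isRepetitiveSeq [G.LocallyFinite] (hN : 0 < N)
    (hg : ∀ v w, G.Adj v w → g v ≠ g w) (hτ : IsSquarefreeWord (N + 1) τ) (ht : 0 < t)
    (hu : IsWalkSeq (subdivision G g N) (2 * t) u) (hne : ∀ i < t, u i ≠ u (t + i))
    (hrep : IsRepetitiveSeq (subdColouring g ψ τ) t u) :
    ∃ p q, ∃ c : (coupledGraph G fun v => (g v, ψ v)).Walk p q,
      0 < c.length ∧ (q.1 = p.2 ∨ G.Adj q.1 p.2) ∧ c.length * (N + 1) ≤ t ∧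
      ∀ i < 2 * t, ∀ z, u i = .inl z → z ∈ coupledVertices c := by
  classical
  have hex := exists_isLeft_of_isRepetitiveSeq hg hτ ht hu (hne 0 ht) hrep
  obtain ⟨i₀, ⟨hi₀, hleft⟩, hmin⟩ : ∃ i₀, (i₀ < t ∧ (u i₀).isLeft) ∧
      ∀ i < i₀, ¬ (i < t ∧ (u i).isLeft) :=
    ⟨Nat.find hex, Nat.find_spec hex, fun i => Nat.find_min hex⟩
  have hsame : ∀ i < t, (u i).isLeft = (u (t + i)).isLeft := fun i hi =>
    isLeft_eq_of_subdColouring_eq (hrep i hi)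
  obtain ⟨z, hz⟩ := Sum.isLeft_iff.1 hleft
  obtain ⟨z', hz'⟩ := Sum.isLeft_iff.1 ((hsame i₀ hi₀).symm.trans hleft)
  obtain ⟨q, c, d, ⟨hgq, hqne⟩, hsync, hlen, hvis⟩ :=
    exists_coupled_walk (p₀ := (z, z')) (m := t - i₀) (i := t - i₀ - 1)
      (x := fun j => u (i₀ + j)) (y := fun j => u (t + (i₀ + j))) (ψ := ψ) (τ := τ) hN hg
      (fun j hj => hu _ (by lia)) (fun j hj => hu _ (by lia)) (fun j hj => hrep _ (by lia))
      (fun j hj => hne _ (by lia)) hz hz' (by lia)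
  have hjoin : q.1 = z' ∨ G.Adj q.1 z' := by
    have hut : u t ∈ closedStar G g N q.1 := hsync.mem_closedStar_of_adj hg <| by
      have := hu (t - 1) (by lia)
      rwa [Nat.sub_add_cancel ht, show t - 1 = i₀ + (t - i₀ - 1) by lia] at this
    have := mem_closedStar_of_isWalkSeq (u := fun j => u (t + j)) (n := i₀) hg
      (fun j hj => hu _ (by lia)) hut
      fun j hj => by rw [← hsame j (by lia)]; exact fun h => hmin j hj ⟨by lia, h⟩
    exact eq_or_adj_of_inl_mem_closedStar (hz' ▸ this)
  have hvisited : ∀ i < t, ∀ z, u i = .inl z ∨ u (t + i) = .inl z → z ∈ coupledVertices c := by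
    intro i hi z hz
    have hl : (u i).isLeft := hz.elim (fun h => by rw [h]; rfl) fun h => by rw [hsame i hi, h]; rfl
    obtain ⟨j, rfl⟩ := Nat.exists_eq_add_of_le (not_lt.1 fun hlt => hmin i hlt ⟨hi, hl⟩)
    exact hvis j (by lia) z hz
  refine ⟨_, q, c, Nat.pos_of_ne_zero fun hc => ?_, hjoin, by lia, fun i hi x hx => ?_⟩
  · obtain rfl := SimpleGraph.Walk.eq_of_length_eq_zero hc
    exact hjoin.elim hqne fun hadj => hg _ _ hadj hgq
  · obtain hit | ⟨j, rfl⟩ := (lt_or_ge i t).imp_right Nat.exists_eq_add_of_le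
    · exact hvisited i hit x (.inl hx)
    · exact hvisited j (by lia) x (.inr hx)

theorem exists_isShortNowhereBoring_of_subdivision [G.LocallyFinite] (hN : 0 < N)
    (hg : ∀ v w, G.Adj v w → g v ≠ g w) (hτ : IsSquarefreeWord (N + 1) τ)
    (hD : ∀ v, G.degree v ≤ D) (hu : IsShortNowhereBoring (subdivision G g N) h t u)
    (hrep : IsRepetitiveSeq (subdColouring g ψ τ) t u) :
    ∃ m w, IsShortNowhereBoring G (2 + 2 * h * (D + 1)) m w ∧
      IsRepetitiveSeq (fun v => (g v, ψ v)) m w := by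
  classical
  obtain ⟨i₀, hi₀, hleft⟩ := exists_isLeft_of_isRepetitiveSeq hg hτ hu.pos hu.isWalkSeq
    (hu.ne 0 hu.pos) hrep
  obtain ⟨p, q, c, hc, hjoin, hlen, hvis⟩ :=
    exists_coupled_walk_of_isRepetitiveSeq hN hg hτ hu.pos hu.isWalkSeq hu.ne hrep
  obtain ⟨m, w, hm, hmc, hw, hwrep, hwne, hcard⟩ :=
    exists_isRepetitiveSeq_card_coupledVertices_le hc hjoin
  refine ⟨m, w, ⟨hm, hw, hwne, ?_⟩, hwrep⟩
  have hpos : 0 < #(vertices (2 * m) w) :=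
    Finset.card_pos.2 ⟨w 0, apply_mem_vertices (by lia)⟩
  have hclen : 2 * c.length ≤ h * (#(coupledVertices c) * (D + 1)) := by
    refine Nat.le_of_mul_le_mul_right ?_ N.succ_pos
    calc 2 * c.length * (N + 1) = 2 * (c.length * (N + 1)) := by ring
      _ ≤ 2 * t := by lia
      _ ≤ h * #(vertices (2 * t) u) := by convert hu.length_le
      _ ≤ h * (#(coupledVertices c) * ((D + 1) * (N + 1))) :=
        Nat.mul_le_mul_left _ (card_vertices_subdivision_le hg hD hu.isWalkSeq hvis
          (i₀ := i₀) (by lia) hleft)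
      _ = h * (#(coupledVertices c) * (D + 1)) * (N + 1) := by ring
  calc 2 * m ≤ 2 + 2 * c.length := by lia
    _ ≤ 2 * #(vertices (2 * m) w) + h * ((2 * #(vertices (2 * m) w)) * (D + 1)) := by
      refine add_le_add (by lia) (hclen.trans ?_)
      gcongr
      lia
    _ = (2 + 2 * h * (D + 1)) * #(vertices (2 * m) w) := by ring

end Projection

section Walks

variable {V C C' : Type*} {G : SimpleGraph V} {f : V → C} {x y : V} {n t H : ℕ} {w : ℕ → V}

theorem walkLength_eq (p : G.Walk x y) : walkLength p = p.length + 1 :=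
  p.length_support

theorem walkOrder_eq [DecidableEq V] (p : G.Walk x y) :
    walkOrder p = #(vertices (walkLength p) p.getVert) := by
  rw [walkOrder, ← Set.ncard_coe_finset]
  congr 1
  ext z
  simp only [Set.mem_ofPred_eq, Finset.mem_coe, mem_vertices, walkLength_eq, Nat.lt_succ_iff,
    SimpleGraph.Walk.mem_support_iff_exists_getVert, and_comm]

theorem isWalkSeq_getVert (p : G.Walk x y) : IsWalkSeq G (walkLength p) p.getVert :=
  fun i hi => p.adj_getVert_succ (by rw [walkLength_eq] at hi; lia)

theorem IsWalkSeq.exists_walk (hw : IsWalkSeq G (n + 1) w) :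
    ∃ p : G.Walk (w 0) (w n), walkLength p = n + 1 ∧ ∀ i ≤ n, p.getVert i = w i := by
  induction n generalizing w with
  | zero => exact ⟨.nil, rfl, fun i hi => by obtain rfl := Nat.le_zero.1 hi; rfl⟩
  | succ n ih =>
    obtain ⟨p, hp, hpw⟩ := ih (w := fun i => w (i + 1)) fun i hi => hw (i + 1) (by lia)
    refine ⟨.cons (hw 0 (by lia)) p, by simpa [walkLength] using hp, fun i hi => ?_⟩
    obtain _ | i := i
    · rfl
    · exact hpw i (by lia)

theorem isWalkNonrepetitive_iff : IsWalkNonrepetitive G f ↔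
    ∀ t w, IsWalkSeq G (2 * t) w → IsRepetitiveSeq f t w → ∀ i < t, w i = w (t + i) := by
  refine ⟨fun h t w hw hrep i hi => ?_, fun h x y p ⟨t, ht, hrep⟩ =>
    ⟨t, ht, h t _ (ht ▸ isWalkSeq_getVert p) hrep⟩⟩
  obtain ⟨n, hn⟩ : ∃ n, 2 * t = n + 1 := Nat.exists_eq_succ_of_ne_zero (by lia)
  obtain ⟨p, hp, hpw⟩ := (hn ▸ hw).exists_walk
  obtain ⟨s, hs, hboring⟩ := h _ _ p ⟨t, hp.trans hn.symm, fun j hj => by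
    rw [hpw _ (by lia), hpw _ (by lia)]
    exact hrep j hj⟩
  obtain rfl : s = t := by lia
  exact (hpw _ (by lia)).symm.trans ((hboring i hi).trans (hpw _ (by lia)))

theorem AvoidsShort.isPathNonrepetitive (hH : 0 < H) (hf : AvoidsShort G H f) :
    IsPathNonrepetitive G f := by
  rintro x y p hp ⟨t, ht, hrep⟩
  have hlen := walkLength_eq p
  refine hf t _ (.of_injOn hH (by lia) (ht ▸ isWalkSeq_getVert p) fun i hi j hj => ?_) hrep
  rw [← ht, Set.mem_Iio] at hi hj
  exact hp.getVert_injOn (Set.mem_ofPred_eq ▸ by lia) (Set.mem_ofPred_eq ▸ by lia)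

theorem AvoidsShort.of_comp {k : C → C'} (hf : AvoidsShort G H fun v => k (f v)) :
    AvoidsShort G H f :=
  fun t w hw hrep => hf t w hw fun i hi => congrArg k (hrep i hi)

theorem AvoidsShort.comp_injective {k : C → C'} (hk : k.Injective) (hf : AvoidsShort G H f) :
    AvoidsShort G H fun v => k (f v) :=
  fun t w hw hrep => hf t w hw fun i hi => hk (hrep i hi)

theorem IsDistanceTwoColouring.eq_of_isRepetitiveSeq (hf : IsDistanceTwoColouring G f)
    (hw : IsWalkSeq G (2 * t) w) (hrep : IsRepetitiveSeq f t w) {i₀ : ℕ} (hi₀ : i₀ < t)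
    (heq : w i₀ = w (t + i₀)) : ∀ i < t, w i = w (t + i) := by
  have hinj := (isDistanceTwoColouring_iff.1 hf).2
  refine forall_lt_of_forall_iff_succ (fun i hi => ⟨fun h => ?_, fun h => ?_⟩) hi₀ heq
  · refine hinj (w i) (hw i (by lia)) ?_ (hrep _ hi)
    rw [h]
    exact hw (t + i) (by lia)
  · refine hinj (w (i + 1)) (hw i (by lia)).symm ?_ (hrep _ (by lia))
    rw [h]
    exact (hw (t + i) (by lia)).symm

theorem IsWalkNonrepetitive.of_comp {k : C → C'} (hf : IsWalkNonrepetitive G fun v => k (f v)) :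
    IsWalkNonrepetitive G f :=
  fun x y p ⟨t, ht, hrep⟩ => hf x y p ⟨t, ht, fun i hi => congrArg k (hrep i hi)⟩

theorem IsWalkNonrepetitive.comp_injective {k : C → C'} (hk : k.Injective)
    (hf : IsWalkNonrepetitive G f) : IsWalkNonrepetitive G fun v => k (f v) :=
  fun x y p ⟨t, ht, hrep⟩ => hf x y p ⟨t, ht, fun i hi => hk (hrep i hi)⟩

theorem SmallWalksConjecture.exists_forall_isWalkNonrepetitive (hconj : SmallWalksConjecture) :
    ∃ h : ℕ → ℕ, ∀ (V C : Type) [Fintype V] [Fintype C] (G : SimpleGraph V) (f : V → C),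
      IsDistanceTwoColouring G f → AvoidsShort G 1 f → AvoidsShort G (h (Fintype.card C)) f →
      IsWalkNonrepetitive G f := by
  classical
  obtain ⟨h, hh⟩ := hconj
  refine ⟨h, fun V C _ _ G f hdist hpath hshort => ?_⟩
  let e := Fintype.equivFin C
  refine .of_comp (k := e) ?_
  have hdist' : IsDistanceTwoColouring G fun v => e (f v) :=
    fun v w hvw => e.injective.ne (hdist v w hvw)
  by_contra hrep
  simp only [IsWalkNonrepetitive, not_forall] at hrep
  obtain ⟨x, y, p, hp, hp'⟩ := hrep
  obtain ⟨x, y, p, ⟨t, ht, hrep⟩, hboring, hlen⟩ := hh V G _ _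
    ((hpath.comp_injective e.injective).isPathNonrepetitive one_pos) hdist' ⟨x, y, p, hp, hp'⟩
  have hw : IsWalkSeq G (2 * t) p.getVert := ht ▸ isWalkSeq_getVert p
  have hpos := walkLength_eq p
  refine hshort.comp_injective e.injective t p.getVert ⟨by lia, hw, fun i hi heq => ?_, ?_⟩ hrep
  · exact hboring ⟨t, ht, hdist'.eq_of_isRepetitiveSeq hw hrep hi heq⟩
  · rw [walkOrder_eq, ht] at hlen
    convert hlen

theorem IsWalkNonrepetitive.comp_equiv {W : Type*} (e : V ≃ W) {φ : W → C}
    (h : IsWalkNonrepetitive (G.comap e.symm) φ) : IsWalkNonrepetitive G fun v => φ (e v) := by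
  rw [isWalkNonrepetitive_iff] at h ⊢
  exact fun t w hw hrep i hi => e.injective <|
    h t (fun i => e (w i)) (fun i hi => by simpa using hw i hi) hrep i hi

end Walks

section Palette

variable {V K B C : Type*} {G : SimpleGraph V} {N n t : ℕ} {w : ℕ → V}

/-- The colouring that shows at each vertex its colour together with the set of colours of its
neighbours. -/
def paletteColouring (G : SimpleGraph V) (f : V → C) (v : V) : C × Set C :=
  (f v, f '' G.neighborSet v)

theorem exists_extension_of_paletteColouring {f : V → C} (ht : 0 < t)
    (hw : IsWalkSeq G (2 * t) w) (hrep : IsRepetitiveSeq (paletteColouring G f) t w) :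
    ∃ w', (∀ i < 2 * t, w' i = w i) ∧ IsWalkSeq G (2 * t + 1) w' ∧
      ∀ i ≤ t, f (w' i) = f (w' (t + i)) := by
  have hmem : f (w t) ∈ f '' G.neighborSet (w (2 * t - 1)) := by
    have hpal := congrArg Prod.snd (hrep (t - 1) (by lia))
    have hadj := hw (t - 1) (by lia)
    rw [Nat.sub_add_cancel ht] at hadj
    rw [show 2 * t - 1 = t + (t - 1) by lia]
    exact hpal.subset (Set.mem_image_of_mem f hadj)
  obtain ⟨z, hz, hfz⟩ := hmem
  have hlt : ∀ i < 2 * t, Function.update w (2 * t) z i = w i :=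
    fun i hi => Function.update_of_ne hi.ne _ _
  refine ⟨Function.update w (2 * t) z, hlt, fun i hi => ?_, fun i hi => ?_⟩
  · obtain hi' | hi' := (Nat.lt_succ_iff.1 hi).lt_or_eq
    · rw [hlt _ (by lia), hlt _ hi']
      exact hw i hi'
    · obtain rfl : i = 2 * t - 1 := by lia
      rwa [hi', Function.update_self, hlt _ (by lia)]
  · obtain hi | rfl := hi.lt_or_eq
    · rw [hlt _ (by lia), hlt _ (by lia)]
      exact congrArg Prod.fst (hrep i hi)
    · rw [hlt _ (by lia), ← two_mul, Function.update_self, hfz]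

variable [LinearOrder K] {g : V → K} {ψ : V → Fin N} {τ : ℕ → B}

/-- The sequence in the subdivided graph that follows the sequence `w` along the subdivided
edges. -/
def subdividedSeq (g : V → K) (N : ℕ) (w : ℕ → V) (i : ℕ) : SubdVertex V N :=
  subdPoint g N (w (i / (N + 1))) (w (i / (N + 1) + 1)) (i % (N + 1))

theorem subdividedSeq_mul_add {q r : ℕ} (hr : r ≤ N + 1) :
    subdividedSeq g N w (q * (N + 1) + r) = subdPoint g N (w q) (w (q + 1)) r := by
  obtain hr | rfl := hr.lt_or_eq
  · rw [subdividedSeq, mul_comm, Nat.mul_add_div N.succ_pos, Nat.mul_add_mod,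
      Nat.div_eq_of_lt hr, Nat.mod_eq_of_lt hr, add_zero]
  · rw [subdividedSeq, ← Nat.succ_mul, Nat.mul_div_cancel _ N.succ_pos, Nat.mul_mod_left,
      subdPoint_zero, subdPoint_last]

theorem exists_eq_mul_add_of_lt_mul {i : ℕ} (hi : i < n * (N + 1)) :
    ∃ q < n, ∃ r ≤ N, i = q * (N + 1) + r :=
  ⟨i / (N + 1), (Nat.div_lt_iff_lt_mul N.succ_pos).2 hi, i % (N + 1),
    Nat.lt_succ_iff.1 (Nat.mod_lt _ N.succ_pos), (Nat.div_add_mod' _ _).symm⟩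

theorem IsWalkSeq.subdividedSeq (hg : ∀ v w, G.Adj v w → g v ≠ g w) (hw : IsWalkSeq G (n + 1) w) :
    IsWalkSeq (subdivision G g N) (n * (N + 1)) (subdividedSeq g N w) := by
  intro i hi
  obtain ⟨q, hq, r, hr, rfl⟩ := exists_eq_mul_add_of_lt_mul (Nat.lt_of_succ_lt hi)
  rw [add_assoc, subdividedSeq_mul_add (by lia), subdividedSeq_mul_add (by lia)]
  exact subdPoint_adj_succ hg (hw q (by lia)) hr

theorem isRepetitiveSeq_subdividedSeq
    (hrep : ∀ i ≤ t, g (w i) = g (w (t + i)) ∧ ψ (w i) = ψ (w (t + i))) :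
    IsRepetitiveSeq (subdColouring g ψ τ) (t * (N + 1)) (subdividedSeq g N w) := by
  intro i hi
  obtain ⟨q, hq, r, hr, rfl⟩ := exists_eq_mul_add_of_lt_mul hi
  rw [← add_assoc, ← add_mul, subdividedSeq_mul_add (by lia), subdividedSeq_mul_add (by lia)]
  exact subdColouring_subdPoint_congr (hrep q hq.le).1 (hrep (q + 1) hq).1 (hrep q hq.le).2
    (hrep (q + 1) hq).2

theorem IsWalkNonrepetitive.paletteColouring (hg : ∀ v w, G.Adj v w → g v ≠ g w)
    (hsub : IsWalkNonrepetitive (subdivision G g N) (subdColouring g ψ τ)) :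
    IsWalkNonrepetitive G (paletteColouring G fun v => (g v, ψ v)) := by
  rw [isWalkNonrepetitive_iff] at hsub ⊢
  intro t w hw hrep i hi
  obtain ⟨w', hww', hw', hrep'⟩ := exists_extension_of_paletteColouring (by lia) hw hrep
  have heq := hsub (t * (N + 1)) (subdividedSeq g N w')
    (by rw [← mul_assoc]; exact hw'.subdividedSeq hg)
    (isRepetitiveSeq_subdividedSeq fun j hj => Prod.ext_iff.1 (hrep' j hj))
    (i * (N + 1) + 0) (Nat.mul_lt_mul_of_pos_right hi N.succ_pos)
  rw [← add_assoc, ← add_mul, subdividedSeq_mul_add (by lia), subdividedSeq_mul_add (by lia),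
    subdPoint_zero, subdPoint_zero, hww' _ (by lia), hww' _ (by lia)] at heq
  exact Sum.inl_injective heq

end Palette

section SubdividedColouring

variable {V K B : Type*} [LinearOrder K] {G : SimpleGraph V} {N D h : ℕ} {g : V → K}
  {ψ : V → Fin N} {τ : ℕ → B}

theorem AvoidsShort.subdColouring [G.LocallyFinite] (hN : 0 < N)
    (hg : ∀ v w, G.Adj v w → g v ≠ g w) (hτ : IsSquarefreeWord (N + 1) τ)
    (hD : ∀ v, G.degree v ≤ D)
    (hf : AvoidsShort G (2 + 2 * h * (D + 1)) fun v => (g v, ψ v)) :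
    AvoidsShort (subdivision G g N) h (subdColouring g ψ τ) := by
  intro t u hu hrep
  obtain ⟨m, w, hw, hwrep⟩ := exists_isShortNowhereBoring_of_subdivision hN hg hτ hD hu hrep
  exact hf m w hw hwrep

theorem SmallWalksConjecture.exists_isWalkNonrepetitive (hconj : SmallWalksConjecture) (D : ℕ) :
    ∃ k, ∀ (V : Type) [Fintype V] (G : SimpleGraph V) [DecidableRel G.Adj],
      G.maxDegree ≤ D → ∃ φ : V → Fin k, IsWalkNonrepetitive G φ := by
  classical
  obtain ⟨h, hh⟩ := hconj.exists_forall_isWalkNonrepetitive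
  let c := 2 * (8 * (D + D * D + 1) ^ 2) ^ (2 + 2 * 1 * (D + 1))
  let H := 2 + 2 * h (Fintype.card (SubdColour (Fin c) (Fin 144))) * (D + 1)
  let N := 2 * (8 * (D + 1) ^ 2) ^ H
  have hN : 0 < N := by positivity
  obtain ⟨τ, hτ⟩ := exists_isSquarefreeWord (C := Fin 144) (by simp) (N + 1)
  refine ⟨Fintype.card ((Fin c × Fin N) × Set (Fin c × Fin N)), fun V _ G _ hD => ?_⟩
  obtain ⟨g, hgdist, hgshort⟩ := exists_isDistanceTwoColouring_avoidsShort (C := Fin c)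
    (H := 2 + 2 * 1 * (D + 1)) (by lia) hD (by simp [c])
  obtain ⟨ψ, hψ⟩ := exists_avoidsShort (C := Fin N) (H := H) hD (by simp [N])
  have hg := (isDistanceTwoColouring_iff.1 hgdist).1
  have hdeg (v : V) : G.degree v ≤ D := (G.degree_le_maxDegree v).trans hD
  have hpath : AvoidsShort (subdivision G g N) 1 (subdColouring g ψ τ) :=
    .subdColouring hN hg hτ hdeg (.of_comp (k := Prod.fst) hgshort)
  have hshort : AvoidsShort (subdivision G g N) _ (subdColouring g ψ τ) :=
    .subdColouring hN hg hτ hdeg (.of_comp (k := Prod.snd) hψ)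
  have hsub := hh _ _ _ _ (isDistanceTwoColouring_subdColouring hN hgdist) hpath hshort
  exact ⟨_, (hsub.paletteColouring hg).comp_injective (Fintype.equivFin _).injective⟩

end SubdividedColouring

end WalkColouring

theorem mainTheorem4 (hconj : WalkColouring.SmallWalksConjecture) :
    ∃ f : ℕ → ℕ,
      (∀ Δ : ℕ, WalkColouring.sigmaDegree Δ ≤ (f Δ : ℕ∞)) ∧
      ∀ (V : Type*) [Fintype V] (G : SimpleGraph V) [DecidableRel G.Adj],
        ∃ φ : V → Fin (f G.maxDegree), WalkColouring.IsWalkNonrepetitive G φ := by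
  classical
  choose f hf using hconj.exists_isWalkNonrepetitive
  refine ⟨f, fun Δ => iSup_le fun n => iSup_le fun G => iSup_le fun hG => ?_, fun V _ G _ => ?_⟩
  · exact Nat.cast_le.2 (Nat.sInf_le (hf Δ (Fin n) G hG))
  · let e := Fintype.equivFin V
    obtain ⟨φ, hφ⟩ := hf G.maxDegree _ (G.comap e.symm)
      (SimpleGraph.Iso.comap e.symm G).maxDegree_eq.le
    exact ⟨_, hφ.comp_equiv e⟩
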